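/- Let $\Bbbk$ be a field, $\mathbb F=\Bbbk(q)$, and let $I$ be a set with a symmetric bilinear form $\cdot$ on $\mathbb Z\langle I\rangle$ such that $i\cdot i$ is even and nonzero for all $i\in I$ and $a_{ij}:=2\frac{i\cdot j}{i\cdot i}\in\mathbb Z_{\le 0}$ for $i\ne j$. Put $q_i=q^{i\cdot i/2}$. Let $A=\mathbb F\mathbb Z\langle I\rangle$ with basis $g_\mu$ and $H=\mathbb F\mathbb Z\langle I\rangle$ with basis $K_\mu$ ($\mu\in\mathbb Z\langle I\rangle$) be two copies of the group Hopf algebra, with the Hopf pairing $\langle K_i,g_j\rangle=q^{a_{ij}}$ and the algebra morphisms $R,\overline R\colon A\to H$, $R(g_i)=K_i^{i\cdot i/2}$, $\overline R(g_i)=K_i^{-i\cdot i/2}$, with convolution inverses $R^{-*},\overline R^{-*}$. Left $A$-comodules are braided by $\Psi(v\otimes w)=R(w^{(-1)},v^{(-1)})\,w^{(0)}\otimes v^{(0)}$, where $R(a,b)=\langle R(a),b\rangle$ (so $R(g_i,g_j)=q^{i\cdot j}$), and $H$ acts on them by $h\triangleright v=\langle h,v^{(-1)}\rangle v^{(0)}$.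 Let $E$ and $F$ be the $A$-comodules with bases $e_i$, $f_i$ ($i\in I$), coactions $e_i\mapsto g_i\otimes e_i$, $f_i\mapsto g_i^{-1}\otimes f_i$, and pairing $\langle f_i,e_j\rangle=\delta_{ij}/(q_i-q_i^{-1})$. The tensor algebras $T(E)$, $T(F)$ are braided bialgebras with primitive generators, and the pairing extends to $\operatorname{ev}\colon T(F)\otimes T(E)\to\mathbb F$ with $\operatorname{ev}(cc',b)=\operatorname{ev}(c',b_{(1)})\operatorname{ev}(c,b_{(2)})$, $\operatorname{ev}(c,bb')=\operatorname{ev}(c_{(1)},b')\operatorname{ev}(c_{(2)},b)$, $\operatorname{ev}(1,b)=\varepsilon(b)$, $\operatorname{ev}(c,1)=\varepsilon(c)$. Let $B=U_q(\mathfrak n^+)$ and $C=U_q(\mathfrak n^-)$ be the quotients of $T(E)$ and $T(F)$ by the right and the left radical of $\operatorname{ev}$ (the Nichols algebras of $E$ and $F$), with the induced structures and pairing. Let $U_q(\mathfrak g)=\operatorname{Drin}_H(C,B)$ be the algebra generated by $C$, $H$, $B$ (mapped to it by algebra morphisms) with the relations, for $h\in H$, $b\in B$, $c\in C$, $$hb=(h_{(2)}\triangleright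 b)h_{(1)},\qquad hc=(h_{(2)}\triangleright c)h_{(1)},$$ $$(R^{-*}({c_{(1)}}^{(-1)})\triangleright b_{(2)})\,{c_{(1)}}^{(0)}\operatorname{ev}(c_{(2)},b_{(1)})=R^{-*}({c_{(1)}}^{(-1)})\,c_{(2)}\,b_{(1)}\,\overline R^{-*}({b_{(2)}}^{(-1)})\operatorname{ev}({c_{(1)}}^{(0)},{b_{(2)}}^{(0)}),$$ and let the quantum Weyl algebra $D_q(\mathfrak g)=\operatorname{Heis}_H(C,B)$ be the algebra generated by $C$, $H$, $B$ in the same way, with the last relation replaced by $$cb=(R^{-*}({c_{(1)}}^{(-1)})\triangleright b_{(2)})\,{c_{(1)}}^{(0)}\operatorname{ev}(c_{(2)},b_{(1)}).$$ Then $U_q(\mathfrak g)$ is a bialgebra whose counit restricts to the counits of $B$, $C$ and $H$, and whose coproduct is determined by $$\Delta(b)=b_{(1)}\overline R^{-*}({b_{(2)}}^{(-1)})\otimes {b_{(2)}}^{(0)},\qquad \Delta(c)=R^{-*}({c_{(1)}}^{(-1)})c_{(2)}\otimes {c_{(1)}}^{(0)},\qquad \Delta(h)=h_{(2)}\otimes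 h_{(1)};$$ and $D_q(\mathfrak g)$ is a left comodule algebra over $U_q(\mathfrak g)$: there is an algebra morphism $\delta\colon D_q(\mathfrak g)\to U_q(\mathfrak g)\otimes D_q(\mathfrak g)$ with $(\Delta\otimes\mathrm{id})\delta=(\mathrm{id}\otimes\delta)\delta$ and $(\varepsilon\otimes\mathrm{id})\delta=1\otimes \mathrm{id}$, given by $$\delta(b)=b_{(1)}\overline R^{-*}({b_{(2)}}^{(-1)})\otimes {b_{(2)}}^{(0)},\qquad \delta(c)=R^{-*}({c_{(1)}}^{(-1)})c_{(2)}\otimes {c_{(1)}}^{(0)},\qquad \delta(h)=h_{(2)}\otimes h_{(1)}$$ for $b\in B$, $c\in C$, $h\in H$. In particular $\delta(e_i)=e_i\otimes 1+K_i^{i\cdot i/2}\otimes e_i$, $\delta(f_i)=f_i\otimes 1+K_i^{i\cdot i/2}\otimes f_i$ and $\delta(K_i)=K_i\otimes K_i$. -/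

import Mathlib

open scoped TensorProduct

noncomputable section

namespace QuantumWeyl

/-! ### Cartan data -/

/-- A Cartan datum on the index set `I`: a symmetric bilinear form on the free abelian group on `I`
with `i · i` even and nonzero, and `2 (i · j) / (i · i)` a nonpositive integer for `i ≠ j`. -/
structure CartanDatum (I : Type*) where
  form : LinearMap.BilinForm ℤ (I →₀ ℤ)
  symm : ∀ μ ν, form μ ν = form ν μ
  even : ∀ i, Even (form (Finsupp.single i 1) (Finsupp.single i 1))
  ne_zero : ∀ i, form (Finsupp.single i 1) (Finsupp.single i 1) ≠ 0
  dvd : ∀ i j, i ≠ j → form (Finsupp.single i 1) (Finsupp.single i 1) ∣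
    2 * form (Finsupp.single i 1) (Finsupp.single j 1)
  nonpos : ∀ i j, i ≠ j → 2 * form (Finsupp.single i 1) (Finsupp.single j 1) /
    form (Finsupp.single i 1) (Finsupp.single i 1) ≤ 0

namespace CartanDatum

variable {I : Type*} (X : CartanDatum I)

/-- The number `i · j`. -/
def dot (i j : I) : ℤ := X.form (Finsupp.single i 1) (Finsupp.single j 1)

/-- The Cartan integer `a_ij = 2 (i · j) / (i · i)` (the division is exact). -/
def a (i j : I) : ℤ := 2 * X.dot i j / X.dot i i

/-- The biadditive extension of `(i, j) ↦ a_ij` to the lattice. -/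
def cartanForm : (I →₀ ℤ) →ₗ[ℤ] (I →₀ ℤ) →ₗ[ℤ] ℤ :=
  Finsupp.linearCombination ℤ fun i => Finsupp.linearCombination ℤ fun j => X.a i j

/-- The additive map of the lattice with `i ↦ (i · i / 2) i`. -/
def half : (I →₀ ℤ) →ₗ[ℤ] (I →₀ ℤ) :=
  Finsupp.linearCombination ℤ fun i => Finsupp.single i (X.dot i i / 2)

lemma dot_self_ne (i : I) : X.dot i i ≠ 0 := X.ne_zero i

lemma dot_comm (i j : I) : X.dot i j = X.dot j i := X.symm _ _

lemma half_mul_a (i j : I) : X.dot i i / 2 * X.a i j = X.dot i j := by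
  have h2 : X.dot i i / 2 * 2 = X.dot i i := Int.ediv_mul_cancel (X.even i).two_dvd
  have hd : X.dot i i ∣ 2 * X.dot i j := by
    by_cases h : i = j
    · subst h
      exact Dvd.intro_left _ rfl
    · exact X.dvd i j h
  have ha : X.dot i i * X.a i j = 2 * X.dot i j := Int.mul_ediv_cancel' hd
  have : 2 * (X.dot i i / 2 * X.a i j) = 2 * X.dot i j := by
    linear_combination X.a i j * h2 + ha
  linarith

lemma cartanForm_half (μ ν : I →₀ ℤ) : X.cartanForm (X.half μ) ν = X.form μ ν := by
  suffices h : X.cartanForm ∘ₗ X.half = X.form from LinearMap.congr_fun₂ h μ ν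
  ext i j
  have := X.half_mul_a i j
  simp [cartanForm, half, dot] at this ⊢
  exact this

end CartanDatum

/-! ### The weak quasitriangular pair of group algebras -/

variable {F : Type*} [Field F] (q : Fˣ) {I : Type*} (X : CartanDatum I)

variable (F I) in
/-- The group algebra `F ℤ⟨I⟩`, with its Hopf algebra structure. It serves both as `A`,
with basis `g_μ`, and as `H`, with basis `K_μ`. -/
abbrev Lat := AddMonoidAlgebra F (I →₀ ℤ)

variable (F) in
/-- The basis element `g_μ` of `A`, respectively `K_μ` of `H`. -/
abbrev mon (μ : I →₀ ℤ) : Lat F I := AddMonoidAlgebra.single μ 1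

/-- The pairing of `H` and `A` with `⟨K_i, g_j⟩ = q ^ a_ij`. -/
def pairing : Lat F I →ₗ[F] Lat F I →ₗ[F] F :=
  (Finsupp.linearCombination F fun μ =>
    (Finsupp.linearCombination F fun ν => ((q ^ X.cartanForm μ ν : Fˣ) : F)) ∘ₗ
      (AddMonoidAlgebra.coeffLinearEquiv F).toLinearMap) ∘ₗ
    (AddMonoidAlgebra.coeffLinearEquiv F).toLinearMap

variable (F) in
/-- `R : A → H`, `g_i ↦ K_i ^ (i · i / 2)`. -/
def R : Lat F I →ₐ[F] Lat F I :=
  AddMonoidAlgebra.mapDomainAlgHom F F X.half.toAddMonoidHom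

variable (F) in
/-- `R̄ : A → H`, `g_i ↦ K_i ^ (- i · i / 2)`. -/
def Rbar : Lat F I →ₐ[F] Lat F I :=
  AddMonoidAlgebra.mapDomainAlgHom F F (-X.half).toAddMonoidHom

variable (F) in
/-- The convolution inverse of `R` (for an algebra morphism: composition with the antipode). -/
def Rinv : Lat F I →ₗ[F] Lat F I := (R F X).toLinearMap ∘ₗ HopfAlgebra.antipode F

variable (F) in
/-- The convolution inverse of `R̄`. -/
def RbarInv : Lat F I →ₗ[F] Lat F I := (Rbar F X).toLinearMap ∘ₗ HopfAlgebra.antipode F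

/-- The dual R-matrix `R(a, b) = ⟨R(a), b⟩` on `A`; thus `R(g_i, g_j) = q ^ (i · j)`. -/
def dualR : Lat F I →ₗ[F] Lat F I →ₗ[F] F := pairing q X ∘ₗ (R F X).toLinearMap

lemma pairing_mon (μ ν : I →₀ ℤ) :
    pairing q X (mon F μ) (mon F ν) = ((q ^ X.cartanForm μ ν : Fˣ) : F) := by
  simp [pairing, mon]

lemma R_mon (μ : I →₀ ℤ) : R F X (mon F μ) = mon F (X.half μ) := by
  simp [R, mon]

lemma Rinv_mon (μ : I →₀ ℤ) : Rinv F X (mon F μ) = mon F (-X.half μ) := by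
  simp [Rinv, R, mon]

lemma RbarInv_mon (μ : I →₀ ℤ) : RbarInv F X (mon F μ) = mon F (X.half μ) := by
  simp [RbarInv, Rbar, mon]

lemma dualR_mon (μ ν : I →₀ ℤ) :
    dualR q X (mon F μ) (mon F ν) = ((q ^ X.form μ ν : Fˣ) : F) := by
  simp only [dualR, LinearMap.comp_apply, AlgHom.toLinearMap_apply, R_mon, pairing_mon,
    X.cartanForm_half]

/-! ### The tensor algebras of `E` and `F` as braided bialgebras -/

variable (F I) in
/-- The tensor algebra of the space with basis `I`. -/
abbrev T := FreeAlgebra F I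

/-- The generator with index `i` of the tensor algebra. -/
abbrev gen (i : I) : T F I := FreeAlgebra.ι F i

variable (I) in
/-- `e_i` has degree `i`. -/
def degE (i : I) : I →₀ ℤ := Finsupp.single i 1

variable (I) in
/-- `f_i` has degree `-i`. -/
def degF (i : I) : I →₀ ℤ := -Finsupp.single i 1

variable (F) in
/-- The left `A`-coaction on the tensor algebra for which the generator `i` has degree `d i`;
as the coaction of a comodule algebra it is an algebra morphism. -/
def coactT (d : I → I →₀ ℤ) : T F I →ₐ[F] Lat F I ⊗[F] T F I :=
  FreeAlgebra.lift F fun i => mon F (d i) ⊗ₜ[F] gen i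

/-- The braiding `Ψ(v ⊗ w) = R(w⁽⁻¹⁾, v⁽⁻¹⁾) w⁽⁰⁾ ⊗ v⁽⁰⁾` of left `A`-comodules,
on the tensor algebra. -/
def braidT (d : I → I →₀ ℤ) : T F I ⊗[F] T F I →ₗ[F] T F I ⊗[F] T F I :=
  (TensorProduct.lid F _).toLinearMap ∘ₗ
    TensorProduct.map
      (TensorProduct.lift (dualR q X) ∘ₗ (TensorProduct.comm F _ _).toLinearMap)
      (TensorProduct.comm F _ _).toLinearMap ∘ₗ
    (TensorProduct.tensorTensorTensorComm F _ _ _ _).toLinearMap ∘ₗ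
    TensorProduct.map (coactT F d).toLinearMap (coactT F d).toLinearMap

/-- The product `(m ⊗ m)(Id ⊗ Ψ ⊗ Id)` of the braided tensor product of the tensor algebra
with itself. -/
def braidedMul (d : I → I →₀ ℤ) :
    T F I ⊗[F] T F I →ₗ[F] T F I ⊗[F] T F I →ₗ[F] T F I ⊗[F] T F I :=
  TensorProduct.curry <|
    TensorProduct.map (LinearMap.mul' F (T F I)) (LinearMap.mul' F (T F I)) ∘ₗ
    (TensorProduct.assoc F _ _ _).symm.toLinearMap ∘ₗ
    LinearMap.lTensor _ ((TensorProduct.assoc F _ _ _).toLinearMap ∘ₗ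
      LinearMap.rTensor _ (braidT q X d) ∘ₗ (TensorProduct.assoc F _ _ _).symm.toLinearMap) ∘ₗ
    (TensorProduct.assoc F _ _ _).toLinearMap

/-- The braided coproduct of the tensor algebra: the algebra morphism to the braided tensor product
for which the generators are primitive, that is, `Δ(1) = 1 ⊗ 1` and
`Δ(v x) = (v ⊗ 1 + 1 ⊗ v) Δ(x)` for every generator `v`. -/
def comulT (d : I → I →₀ ℤ) : T F I →ₗ[F] T F I ⊗[F] T F I :=
  LinearMap.applyₗ (1 ⊗ₜ[F] 1) ∘ₗ
    (FreeAlgebra.lift F fun i =>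
      (braidedMul q X d (gen i ⊗ₜ[F] 1 + 1 ⊗ₜ[F] gen i) :
        Module.End F (T F I ⊗[F] T F I))).toLinearMap

variable (F I) in
/-- The counit of the tensor algebra. -/
def counitT : T F I →ₐ[F] F := FreeAlgebra.algebraMapInv

/-- `q_i = q ^ (i · i / 2)`. -/
def qi (i : I) : F := ((q ^ (X.dot i i / 2) : Fˣ) : F)

open Classical in
/-- The functional `⟨f_j, -⟩` on the tensor algebra of `E`: it sends `e_i` to
`δ_ij / (q_i - q_i⁻¹)` and vanishes on all words of length different from one. -/
def pairGen (j : I) : T F I →ₗ[F] F :=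
  TrivSqZeroExt.sndHom F F ∘ₗ
    (FreeAlgebra.lift F fun i =>
      (if i = j then TrivSqZeroExt.inr (qi q X j - (qi q X j)⁻¹)⁻¹ else 0 :
        TrivSqZeroExt F F)).toLinearMap

/-- The map `b ↦ b₍₁₎ ⟨f_j, b₍₂₎⟩` on the tensor algebra of `E`. -/
def skewDer (j : I) : T F I →ₗ[F] T F I :=
  (TensorProduct.rid F _).toLinearMap ∘ₗ LinearMap.lTensor _ (pairGen q X j) ∘ₗ
    comulT q X (degE I)

/-- The bialgebra pairing of the tensor algebras of `F` and `E` that extends the pairing of `F` and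
`E`: `ev(1, b) = ε(b)` and `ev(f_j c, b) = ev(c, b₍₁₎) ⟨f_j, b₍₂₎⟩`. -/
def evT : T F I →ₗ[F] T F I →ₗ[F] F :=
  LinearMap.applyₗ (counitT F I).toLinearMap ∘ₗ
    (FreeAlgebra.lift F fun j =>
      ((skewDer q X j).dualMap : Module.End F (Module.Dual F (T F I)))).toLinearMap

/-! ### Properties of the coproduct and the pairing needed to pass to the quotients -/

section Aux

variable {X}

lemma T_induct {P : T F I → Prop} (one : P 1) (gen_mul : ∀ i y, P y → P (gen i * y))
    (add : ∀ x y, P x → P y → P (x + y)) (smul : ∀ (r : F) y, P y → P (r • y)) (x : T F I) :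
    P x := by
  suffices h : ∀ y, P y → P (x * y) by simpa using h 1 one
  induction x using FreeAlgebra.induction with
  | grade0 r =>
    intro y hy
    rw [← Algebra.smul_def]
    exact smul r y hy
  | grade1 i => exact gen_mul i
  | mul a b ha hb =>
    intro y hy
    rw [mul_assoc]
    exact ha _ (hb _ hy)
  | add a b ha hb =>
    intro y hy
    rw [add_mul]
    exact add _ _ (ha _ hy) (hb _ hy)

lemma T_ext {M : Type*} [AddCommGroup M] [Module F M] {f g : T F I →ₗ[F] M} (one : f 1 = g 1)
    (gen_mul : ∀ i y, f y = g y → f (gen i * y) = g (gen i * y)) : f = g := by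
  ext x
  induction x using T_induct with
  | one => exact one
  | gen_mul i y h => exact gen_mul i y h
  | add x y hx hy => rw [map_add, map_add, hx, hy]
  | smul r y hy => rw [map_smul, map_smul, hy]

variable (X)

/-- `x ↦ q ^ (i · |x|) x`. -/
def tw (i : I) : T F I →ₐ[F] T F I :=
  FreeAlgebra.lift F fun j => ((q ^ X.dot i j : Fˣ) : F) • gen j

lemma tw_gen_mul (i j : I) (x : T F I) :
    tw q X i (gen j * x) = ((q ^ X.dot i j : Fˣ) : F) • (gen j * tw q X i x) := by
  simp [tw]

lemma tw_comm (i j : I) (x : T F I) : tw q X i (tw q X j x) = tw q X j (tw q X i x) := by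
  suffices h : (tw q X i).comp (tw q X j) = (tw q X j).comp (tw q X i) from
    DFunLike.congr_fun h x
  ext k
  simp [tw, smul_smul, mul_comm]

lemma counitT_tw (i : I) (x : T F I) : counitT F I (tw q X i x) = counitT F I x := by
  suffices h : (counitT F I).comp (tw q X i) = counitT F I from DFunLike.congr_fun h x
  ext k
  simp [tw, counitT, FreeAlgebra.algebraMapInv]

lemma counitT_gen_mul (i : I) (x : T F I) : counitT F I (gen i * x) = 0 := by
  simp [counitT, FreeAlgebra.algebraMapInv]

lemma dualR_mul (μ ν : I →₀ ℤ) (x : Lat F I) :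
    dualR q X (mon F μ * x) (mon F ν) =
      ((q ^ X.form μ ν : Fˣ) : F) * dualR q X x (mon F ν) := by
  induction x using AddMonoidAlgebra.induction_linear with
  | zero => simp
  | add x y hx hy => rw [mul_add, map_add, map_add, LinearMap.add_apply, LinearMap.add_apply,
      hx, hy, mul_add]
  | single κ r =>
    have h : (AddMonoidAlgebra.single κ r : Lat F I) = r • mon F κ := by simp [mon]
    have h' : mon F μ * mon F κ = mon F (μ + κ) := by simp [mon]
    rw [h, mul_smul_comm, h', map_smul, map_smul, LinearMap.smul_apply, LinearMap.smul_apply,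
      dualR_mon, dualR_mon, map_add, LinearMap.add_apply, zpow_add]
    simp only [Units.val_mul, smul_eq_mul]
    ring

/-- `w ↦ R(w⁽⁻¹⁾, g_μ) w⁽⁰⁾`, before the coaction is applied. -/
def evalR (μ : I →₀ ℤ) : Lat F I ⊗[F] T F I →ₗ[F] T F I :=
  (TensorProduct.lid F _).toLinearMap ∘ₗ LinearMap.rTensor _ ((dualR q X).flip (mon F μ))

lemma evalR_coact (d : I → I →₀ ℤ) (μ : I →₀ ℤ) (x : T F I) :
    evalR q X μ (coactT F d x) =
      FreeAlgebra.lift F (fun j => ((q ^ X.form (d j) μ : Fˣ) : F) • gen j) x := by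
  induction x using T_induct with
  | one =>
    have : (1 : Lat F I) = mon F 0 := rfl
    rw [map_one (coactT F d), map_one (FreeAlgebra.lift F _), Algebra.TensorProduct.one_def, this]
    simp [evalR, dualR_mon]
  | gen_mul i y h =>
    have key : ∀ t, evalR q X μ ((mon F (d i) ⊗ₜ[F] gen i) * t) =
        ((q ^ X.form (d i) μ : Fˣ) : F) • (gen i * evalR q X μ t) := by
      intro t
      induction t with
      | zero => simp
      | add s t hs ht => rw [mul_add, map_add, map_add, hs, ht, mul_add, smul_add]
      | tmul a b =>
        simp [evalR, dualR_mul, mul_smul]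
    rw [map_mul (coactT F d), map_mul (FreeAlgebra.lift F _), ← h]
    simp only [coactT, FreeAlgebra.lift_ι_apply]
    rw [smul_mul_assoc]
    exact key _
  | add x y hx hy => simp only [map_add, hx, hy]
  | smul r y hy => simp only [map_smul, hy]

lemma braidT_apply (d : I → I →₀ ℤ) {μ : I →₀ ℤ} {v : T F I}
    (hv : coactT F d v = mon F μ ⊗ₜ[F] v) (x : T F I) :
    braidT q X d (v ⊗ₜ[F] x) =
      FreeAlgebra.lift F (fun j => ((q ^ X.form (d j) μ : Fˣ) : F) • gen j) x ⊗ₜ[F] v := by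
  rw [← evalR_coact]
  have key : ((TensorProduct.lid F _).toLinearMap ∘ₗ
      TensorProduct.map
        (TensorProduct.lift (dualR q X) ∘ₗ (TensorProduct.comm F _ _).toLinearMap)
        (TensorProduct.comm F _ _).toLinearMap ∘ₗ
      (TensorProduct.tensorTensorTensorComm F _ _ _ _).toLinearMap) ∘ₗ
      TensorProduct.mk F (Lat F I ⊗[F] T F I) (Lat F I ⊗[F] T F I) (mon F μ ⊗ₜ[F] v) =
      (TensorProduct.mk F _ _).flip v ∘ₗ evalR q X μ :=
    TensorProduct.ext' fun a b => by simp [evalR, TensorProduct.smul_tmul']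
  have := LinearMap.congr_fun key (coactT F d x)
  simp only [braidT, LinearMap.comp_apply, TensorProduct.map_tmul, AlgHom.toLinearMap_apply, hv]
  exact this

/-- Left multiplication by `v ⊗ 1 + 1 ⊗ v` for the generator `v` with index `i`. -/
def opL (i : I) : T F I ⊗[F] T F I →ₗ[F] T F I ⊗[F] T F I :=
  TensorProduct.map (LinearMap.mulLeft F (gen i)) LinearMap.id +
    TensorProduct.map (tw q X i).toLinearMap (LinearMap.mulLeft F (gen i))

lemma opL_tmul (i : I) (x y : T F I) :
    opL q X i (x ⊗ₜ[F] y) = (gen i * x) ⊗ₜ[F] y + tw q X i x ⊗ₜ[F] (gen i * y) := by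
  simp [opL]

lemma braidedMul_gen (d : I → I →₀ ℤ) (hd : ∀ i j, X.form (d i) (d j) = X.dot i j) (i : I)
    (t : T F I ⊗[F] T F I) :
    braidedMul q X d (gen i ⊗ₜ[F] 1 + 1 ⊗ₜ[F] gen i) t = opL q X i t := by
  induction t with
  | zero => simp
  | add s t hs ht =>
    exact (map_add (braidedMul q X d (gen i ⊗ₜ[F] 1 + 1 ⊗ₜ[F] gen i)) s t).trans
      (by rw [hs, ht, map_add])
  | tmul x y =>
    have h1 : coactT F d 1 = mon F 0 ⊗ₜ[F] 1 := map_one _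
    have h2 : coactT F d (gen i) = mon F (d i) ⊗ₜ[F] gen i := by simp [coactT]
    have e1 := braidT_apply q X d h1 x
    have e2 := braidT_apply q X d h2 x
    have e3 : (FreeAlgebra.lift F fun j => ((q ^ X.form (d j) 0 : Fˣ) : F) • gen j) =
        AlgHom.id F (T F I) := by
      ext j
      simp
    have e4 : (FreeAlgebra.lift F fun j => ((q ^ X.form (d j) (d i) : Fˣ) : F) • gen j) =
        tw q X i := by
      ext j
      simp [tw, hd, X.dot_comm j i]
    rw [e3] at e1
    rw [e4] at e2
    rw [opL_tmul, map_add, LinearMap.add_apply]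
    simp only [braidedMul, TensorProduct.curry_apply, LinearMap.comp_apply,
      LinearEquiv.coe_coe, TensorProduct.assoc_tmul, LinearMap.lTensor_tmul,
      TensorProduct.assoc_symm_tmul, LinearMap.rTensor_tmul, e1, e2, TensorProduct.map_tmul,
      LinearMap.mul'_apply, AlgHom.id_apply, one_mul]

lemma comulT_one (d : I → I →₀ ℤ) : comulT q X d 1 = 1 ⊗ₜ[F] 1 := by
  simp [comulT]

lemma comulT_gen_mul (d : I → I →₀ ℤ) (hd : ∀ i j, X.form (d i) (d j) = X.dot i j) (i : I)
    (x : T F I) : comulT q X d (gen i * x) = opL q X i (comulT q X d x) := by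
  rw [← braidedMul_gen q X d hd]
  simp [comulT]

lemma form_degE (i j : I) : X.form (degE I i) (degE I j) = X.dot i j := rfl

lemma form_degF (i j : I) : X.form (degF I i) (degF I j) = X.dot i j := by
  simp [degF, CartanDatum.dot]

lemma comulT_degF : comulT q X (degF I) = comulT q X (degE I) := by
  refine T_ext ?_ fun i y h => ?_
  · rw [comulT_one, comulT_one]
  · rw [comulT_gen_mul q X _ (form_degF X), comulT_gen_mul q X _ (form_degE X), h]

lemma counitT_comulT (x : T F I) :
    TensorProduct.rid F _ (LinearMap.lTensor _ (counitT F I).toLinearMap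
      (comulT q X (degE I) x)) = x := by
  induction x using T_induct with
  | one => simp [comulT_one]
  | gen_mul i y h =>
    rw [comulT_gen_mul q X _ (form_degE X)]
    nth_rewrite 2 [← h]
    generalize comulT q X (degE I) y = t
    induction t with
    | zero => simp
    | add s t hs ht => simp only [map_add, hs, ht, mul_add]
    | tmul a b =>
      simp [opL_tmul, counitT_gen_mul]
  | add x y hx hy => simp only [map_add, hx, hy]
  | smul r y hy => simp only [map_smul, hy]

lemma pairGen_one (j : I) : pairGen q X j (1 : T F I) = 0 := by
  simp [pairGen]

open Classical in
/-- `⟨f_j, e_i⟩`. -/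
def cf (j i : I) : F := if i = j then (qi q X j - (qi q X j)⁻¹)⁻¹ else 0

lemma pairGen_gen_mul (i j : I) (x : T F I) :
    pairGen q X j (gen i * x) = cf q X j i * counitT F I x := by
  classical
  have h : ∀ f : I → TrivSqZeroExt F F, (∀ i, (f i).fst = 0) → ∀ x : T F I,
      (FreeAlgebra.lift F f x).fst = counitT F I x := by
    intro f hf x
    suffices h : (TrivSqZeroExt.fstHom F F F).comp (FreeAlgebra.lift F f) = counitT F I from
      DFunLike.congr_fun h x
    ext k
    simp [hf, counitT, FreeAlgebra.algebraMapInv]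
  simp only [pairGen, LinearMap.comp_apply, AlgHom.toLinearMap_apply, map_mul,
    FreeAlgebra.lift_ι_apply, TrivSqZeroExt.sndHom_apply, TrivSqZeroExt.snd_mul]
  rw [h]
  · by_cases hij : i = j <;> simp [cf, hij, mul_comm]
  · intro i
    split_ifs <;> simp

lemma skewDer_one (j : I) : skewDer q X j (1 : T F I) = 0 := by
  simp [skewDer, comulT_one, pairGen_one]

lemma skewDer_gen_mul (i j : I) (y : T F I) :
    skewDer q X j (gen i * y) = gen i * skewDer q X j y + cf q X j i • tw q X i y := by
  nth_rewrite 3 [← counitT_comulT q X y]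
  simp only [skewDer, LinearMap.comp_apply, comulT_gen_mul q X _ (form_degE X)]
  generalize comulT q X (degE I) y = t
  induction t with
  | zero => simp
  | add s t hs ht =>
    simp only [map_add, hs, ht, mul_add, smul_add]
    abel
  | tmul a b =>
    simp [opL_tmul, pairGen_gen_mul, smul_smul]

lemma skewDer_tw (i j : I) (x : T F I) :
    skewDer q X j (tw q X i x) = ((q ^ X.dot i j : Fˣ) : F) • tw q X i (skewDer q X j x) := by
  induction x using T_induct with
  | one => simp [skewDer_one]
  | gen_mul k y h =>
    rw [tw_gen_mul, map_smul, skewDer_gen_mul, h, skewDer_gen_mul, map_add, tw_gen_mul, map_smul,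
      tw_comm q X k i]
    by_cases hk : k = j
    · subst hk
      simp only [smul_add, mul_smul_comm, smul_smul, mul_comm]
    · simp only [cf, hk, if_false, zero_smul, add_zero, mul_smul_comm, smul_smul, mul_comm]
  | add x y hx hy => simp only [map_add, hx, hy, smul_add]
  | smul r y hy => simp only [map_smul, hy, smul_comm r]

lemma skewDer_mul (j : I) (x y : T F I) :
    skewDer q X j (x * y) = x * skewDer q X j y + skewDer q X j x * tw q X j y := by
  induction x using T_induct with
  | one => simp [skewDer_one]
  | gen_mul k x h =>
    rw [mul_assoc, skewDer_gen_mul, h, skewDer_gen_mul, map_mul]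
    by_cases hk : k = j
    · subst hk
      simp only [mul_add, add_mul, mul_assoc, smul_mul_assoc, add_assoc]
    · simp only [cf, hk, if_false, zero_smul, add_zero, mul_add, mul_assoc]
  | add x y hx hy =>
    simp only [map_add, add_mul, hx, hy]
    abel
  | smul r y hy => simp only [map_smul, smul_mul_assoc, hy, smul_add]

lemma evT_one (b : T F I) : evT q X 1 b = counitT F I b := by
  simp [evT]

lemma evT_gen_mul (j : I) (c b : T F I) :
    evT q X (gen j * c) b = evT q X c (skewDer q X j b) := by
  simp [evT]

lemma evT_gen_mul' (j : I) (c : T F I) :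
    evT q X (gen j * c) = evT q X c ∘ₗ skewDer q X j := by
  ext b
  exact evT_gen_mul q X j c b

lemma evT_tw (j : I) (c b : T F I) : evT q X c (tw q X j b) = evT q X (tw q X j c) b := by
  induction c using T_induct generalizing b with
  | one => simp [evT_one, counitT_tw]
  | gen_mul i y h =>
    rw [evT_gen_mul, skewDer_tw, map_smul, h, tw_gen_mul, map_smul, LinearMap.smul_apply,
      evT_gen_mul]
  | add x y hx hy => simp only [map_add, LinearMap.add_apply, hx, hy]
  | smul r y hy => simp only [map_smul, LinearMap.smul_apply, hy]

lemma evT_mul_right_eq_zero (c x : T F I) (hx : ∀ c, evT q X c x = 0) (y : T F I) :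
    evT q X c (y * x) = 0 := by
  induction c using T_induct generalizing x y with
  | one =>
    have := hx 1
    rw [evT_one] at this ⊢
    rw [map_mul, this, mul_zero]
  | gen_mul j c h =>
    rw [evT_gen_mul, skewDer_mul, map_add, h _ (fun c => by rw [← evT_gen_mul, hx]),
      h _ (fun c => by rw [evT_tw, hx]), add_zero]
  | add a b ha hb => rw [map_add, LinearMap.add_apply, ha x hx, hb x hx, add_zero]
  | smul r a ha => rw [map_smul, LinearMap.smul_apply, ha x hx, smul_zero]

lemma evT_mul_left_eq_zero (c x : T F I) (hx : ∀ c, evT q X c x = 0) (y : T F I) :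
    evT q X c (x * y) = 0 := by
  induction c using T_induct generalizing x y with
  | one =>
    have := hx 1
    rw [evT_one] at this ⊢
    rw [map_mul, this, zero_mul]
  | gen_mul j c h =>
    rw [evT_gen_mul, skewDer_mul, map_add, h _ hx,
      h _ (fun c => by rw [← evT_gen_mul, hx]), add_zero]
  | add a b ha hb => rw [map_add, LinearMap.add_apply, ha x hx, hb x hx, add_zero]
  | smul r a ha => rw [map_smul, LinearMap.smul_apply, ha x hx, smul_zero]

lemma comulT_tw (i : I) (x : T F I) :
    comulT q X (degE I) (tw q X i x) =
      TensorProduct.map (tw q X i).toLinearMap (tw q X i).toLinearMap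
        (comulT q X (degE I) x) := by
  induction x using T_induct with
  | one => simp [comulT_one]
  | gen_mul k y h =>
    rw [tw_gen_mul, map_smul, comulT_gen_mul q X _ (form_degE X),
      comulT_gen_mul q X _ (form_degE X), h]
    generalize comulT q X (degE I) y = t
    induction t with
    | zero => simp
    | add s t hs ht => simp only [map_add, smul_add, hs, ht]
    | tmul a b =>
      simp only [opL_tmul, map_add, TensorProduct.map_tmul, AlgHom.toLinearMap_apply, tw_gen_mul,
        tw_comm q X k i, smul_add, TensorProduct.smul_tmul', TensorProduct.tmul_smul]
  | add x y hx hy => simp only [map_add, hx, hy]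
  | smul r y hy => simp only [map_smul, hy]

lemma comulT_skewDer (j : I) (x : T F I) :
    comulT q X (degE I) (skewDer q X j x) =
      LinearMap.lTensor _ (skewDer q X j) (comulT q X (degE I) x) := by
  induction x using T_induct with
  | one => simp [comulT_one, skewDer_one]
  | gen_mul i y h =>
    rw [skewDer_gen_mul, map_add, map_smul, comulT_gen_mul q X _ (form_degE X),
      comulT_gen_mul q X _ (form_degE X), h, comulT_tw]
    generalize comulT q X (degE I) y = t
    induction t with
    | zero => simp
    | add s t hs ht =>
      simp only [map_add, smul_add, ← hs, ← ht]
      abel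
    | tmul a b =>
      simp [opL_tmul, skewDer_gen_mul, TensorProduct.tmul_add, add_assoc]
  | add x y hx hy => simp only [map_add, hx, hy]
  | smul r y hy => simp only [map_smul, hy]

lemma evT_mul (c y b : T F I) :
    evT q X (c * y) b = TensorProduct.lid F F
      (TensorProduct.map (evT q X y) (evT q X c) (comulT q X (degE I) b)) := by
  induction c using T_induct generalizing b with
  | one =>
    rw [one_mul]
    nth_rewrite 1 [← counitT_comulT q X b]
    generalize comulT q X (degE I) b = t
    induction t with
    | zero => simp
    | add s t hs ht => simp only [map_add, hs, ht]
    | tmul u v => simp [evT_one, mul_comm]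
  | gen_mul j c h =>
    rw [mul_assoc, evT_gen_mul, h, comulT_skewDer, evT_gen_mul', ← LinearMap.comp_apply,
      ← LinearMap.comp_apply, LinearMap.lTensor, ← TensorProduct.map_comp, LinearMap.comp_id]
    rfl
  | add a c ha hc =>
    rw [add_mul, map_add, map_add, LinearMap.add_apply, ha, hc, TensorProduct.map_add_right,
      LinearMap.add_apply, map_add]
  | smul r c hc =>
    rw [smul_mul_assoc, map_smul, map_smul, LinearMap.smul_apply, hc,
      TensorProduct.map_smul_right, LinearMap.smul_apply, map_smul]

lemma evT_mul' (c b b' : T F I) :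
    evT q X c (b * b') = TensorProduct.lid F F
      (TensorProduct.map ((evT q X).flip b') ((evT q X).flip b) (comulT q X (degE I) c)) := by
  induction c using T_induct generalizing b b' with
  | one => simp [evT_one, comulT_one, mul_comm]
  | gen_mul j c h =>
    rw [evT_gen_mul, skewDer_mul, map_add, h, h, comulT_gen_mul q X _ (form_degE X)]
    generalize comulT q X (degE I) c = t
    induction t with
    | zero => simp
    | add s t hs ht =>
      simp only [map_add, ← hs, ← ht]
      abel
    | tmul u v => simp [opL_tmul, evT_gen_mul, evT_tw]
  | add a c ha hc => rw [map_add, LinearMap.add_apply, ha, hc, map_add, map_add, map_add]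
  | smul r c hc => rw [map_smul, LinearMap.smul_apply, hc, map_smul, map_smul, map_smul]

lemma coactT_gen_mul (d : I → I →₀ ℤ) (i : I) (x : T F I) :
    coactT F d (gen i * x) = (mon F (d i) ⊗ₜ[F] gen i) * coactT F d x := by
  simp [coactT]

lemma coactT_tw (d : I → I →₀ ℤ) (i : I) (x : T F I) :
    coactT F d (tw q X i x) = LinearMap.lTensor _ (tw q X i).toLinearMap (coactT F d x) := by
  induction x using T_induct with
  | one => simp [Algebra.TensorProduct.one_def]
  | gen_mul k y h =>
    rw [tw_gen_mul, map_smul, coactT_gen_mul, coactT_gen_mul, h]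
    generalize coactT F d y = t
    induction t with
    | zero => simp
    | add s t hs ht => simp only [map_add, mul_add, smul_add, hs, ht]
    | tmul a b => simp [tw_gen_mul]
  | add x y hx hy => simp only [map_add, hx, hy]
  | smul r y hy => simp only [map_smul, hy]

lemma coactT_skewDer (j : I) (x : T F I) :
    LinearMap.lTensor _ (skewDer q X j) (coactT F (degE I) x) =
      (mon F (degE I j) ⊗ₜ[F] 1) * coactT F (degE I) (skewDer q X j x) := by
  induction x using T_induct with
  | one => simp [Algebra.TensorProduct.one_def, skewDer_one]
  | gen_mul i y h =>
    rw [skewDer_gen_mul, map_add, map_smul, coactT_gen_mul, coactT_gen_mul, coactT_tw]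
    have key : ∀ t : Lat F I ⊗[F] T F I,
        LinearMap.lTensor _ (skewDer q X j) ((mon F (degE I i) ⊗ₜ[F] gen i) * t) =
          (mon F (degE I i) ⊗ₜ[F] gen i) * LinearMap.lTensor _ (skewDer q X j) t +
          cf q X j i • ((mon F (degE I i) ⊗ₜ[F] 1) *
            LinearMap.lTensor _ (tw q X i).toLinearMap t) := by
      intro t
      induction t with
      | zero => simp
      | add s t hs ht =>
        simp only [map_add, mul_add, smul_add, hs, ht]
        abel
      | tmul a b =>
        simp only [Algebra.TensorProduct.tmul_mul_tmul, LinearMap.lTensor_tmul, skewDer_gen_mul,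
          TensorProduct.tmul_add, TensorProduct.tmul_smul, one_mul, AlgHom.toLinearMap_apply]
    have comm : (mon F (degE I i) ⊗ₜ[F] gen i) * (mon F (degE I j) ⊗ₜ[F] (1 : T F I)) =
        (mon F (degE I j) ⊗ₜ[F] 1) * (mon F (degE I i) ⊗ₜ[F] gen i) := by
      rw [Algebra.TensorProduct.tmul_mul_tmul, Algebra.TensorProduct.tmul_mul_tmul, mul_comm,
        mul_one, one_mul]
    rw [key, h, ← mul_assoc, comm, mul_assoc, mul_add, mul_smul_comm]
    by_cases hij : i = j
    · subst hij
      rfl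
    · simp [cf, hij]
  | add x y hx hy => simp only [map_add, hx, hy, mul_add]
  | smul r y hy => simp only [map_smul, hy, mul_smul_comm]

lemma lTensor_counitT (d : I → I →₀ ℤ) (x : T F I) :
    LinearMap.lTensor _ (counitT F I).toLinearMap (coactT F d x) = 1 ⊗ₜ[F] counitT F I x := by
  induction x using T_induct with
  | one => simp [Algebra.TensorProduct.one_def]
  | gen_mul i y h =>
    rw [coactT_gen_mul, counitT_gen_mul, TensorProduct.tmul_zero]
    generalize coactT F d y = t
    induction t with
    | zero => simp
    | add s t hs ht => rw [mul_add, map_add, hs, ht, add_zero]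
    | tmul a b => simp [counitT_gen_mul]
  | add x y hx hy => simp only [map_add, hx, hy, TensorProduct.tmul_add]
  | smul r y hy => simp only [map_smul, hy, TensorProduct.tmul_smul]

lemma lTensor_evT_mul (μ : I →₀ ℤ) (φ : T F I →ₗ[F] F) (t : Lat F I ⊗[F] T F I) :
    TensorProduct.rid F _ (LinearMap.lTensor _ φ ((mon F μ ⊗ₜ[F] 1) * t)) =
      mon F μ * TensorProduct.rid F _ (LinearMap.lTensor _ φ t) := by
  induction t with
  | zero => simp
  | add s t hs ht => simp only [map_add, mul_add, hs, ht]
  | tmul a b => simp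

lemma coactT_mem_radPlus (c x : T F I) (hx : ∀ c, evT q X c x = 0) :
    TensorProduct.rid F _ (LinearMap.lTensor _ (evT q X c) (coactT F (degE I) x)) = 0 := by
  induction c using T_induct generalizing x with
  | one =>
    have h1 : evT q X 1 = (counitT F I).toLinearMap := LinearMap.ext (evT_one q X)
    rw [h1, lTensor_counitT, ← evT_one q X, hx, TensorProduct.tmul_zero, map_zero]
  | gen_mul j c h =>
    rw [evT_gen_mul', LinearMap.lTensor_comp, LinearMap.comp_apply, coactT_skewDer,
      lTensor_evT_mul, h _ (fun c => by rw [← evT_gen_mul, hx]), mul_zero]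
  | add a b ha hb =>
    rw [map_add, LinearMap.lTensor_add, LinearMap.add_apply, map_add, ha x hx, hb x hx, add_zero]
  | smul r a ha =>
    rw [map_smul, LinearMap.lTensor_smul, LinearMap.smul_apply, map_smul, ha x hx, smul_zero]

variable (F I) in
/-- `g_μ ↦ g_{-μ}`. -/
def negLat : Lat F I →ₐ[F] Lat F I :=
  AddMonoidAlgebra.mapDomainAlgHom F F (-AddMonoidHom.id (I →₀ ℤ))

lemma coactT_degF (c b : T F I) :
    TensorProduct.rid F _ (LinearMap.lTensor _ ((evT q X).flip b) (coactT F (degF I) c)) =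
      negLat F I (TensorProduct.rid F _
        (LinearMap.lTensor _ (evT q X c) (coactT F (degE I) b))) := by
  induction c using T_induct generalizing b with
  | one =>
    have h1 : evT q X 1 = (counitT F I).toLinearMap := LinearMap.ext (evT_one q X)
    rw [h1, lTensor_counitT, map_one, Algebra.TensorProduct.one_def, LinearMap.lTensor_tmul,
      LinearMap.flip_apply, evT_one, TensorProduct.rid_tmul, map_smul, map_one (negLat F I)]
  | gen_mul j c h =>
    have key : ∀ t : Lat F I ⊗[F] T F I,
        TensorProduct.rid F _ (LinearMap.lTensor _ ((evT q X).flip b)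
          ((mon F (degF I j) ⊗ₜ[F] gen j) * t)) =
        mon F (degF I j) * TensorProduct.rid F _
          (LinearMap.lTensor _ ((evT q X).flip (skewDer q X j b)) t) := by
      intro t
      induction t with
      | zero => simp
      | add s t hs ht => simp only [map_add, mul_add, hs, ht]
      | tmul a b => simp [evT_gen_mul]
    have hneg : negLat F I (mon F (degE I j)) = mon F (degF I j) := by
      simp [negLat, mon, degE, degF]
    rw [coactT_gen_mul, key, h, evT_gen_mul', LinearMap.lTensor_comp, LinearMap.comp_apply,
      coactT_skewDer, lTensor_evT_mul, map_mul, hneg]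
  | add a c ha hc =>
    simp only [map_add, ha, hc, LinearMap.lTensor_add, LinearMap.add_apply]
  | smul r c hc =>
    simp only [map_smul, hc, LinearMap.lTensor_smul, LinearMap.smul_apply]

lemma eq_zero_of_lTensor {ι V W : Type*} [AddCommGroup V] [Module F V] [AddCommGroup W]
    [Module F W] (φ : ι → W →ₗ[F] F) (hφ : ∀ w, (∀ i, φ i w = 0) → w = 0) (t : V ⊗[F] W)
    (ht : ∀ i, TensorProduct.rid F V (LinearMap.lTensor V (φ i) t) = 0) : t = 0 := by
  classical
  let b := Module.Basis.ofVectorSpace F V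
  let e := TensorProduct.equivFinsuppOfBasisLeft (N := W) b
  have key : ∀ t i k, φ i (e t k) =
      b.coord k (TensorProduct.rid F V (LinearMap.lTensor V (φ i) t)) := by
    intro t i k
    induction t with
    | zero => simp
    | add s t hs ht => simp only [map_add, Finsupp.add_apply, hs, ht]
    | tmul v w => simp [e, mul_comm]
  apply e.injective
  ext k
  rw [map_zero, Finsupp.zero_apply]
  apply hφ
  intro i
  rw [key, ht, map_zero]

lemma eq_zero_of_map {ι κ V W : Type*} [AddCommGroup V] [Module F V] [AddCommGroup W]
    [Module F W] (φ : ι → V →ₗ[F] F) (hφ : ∀ v, (∀ i, φ i v = 0) → v = 0)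
    (ψ : κ → W →ₗ[F] F) (hψ : ∀ w, (∀ k, ψ k w = 0) → w = 0) (t : V ⊗[F] W)
    (ht : ∀ i k, TensorProduct.lid F F (TensorProduct.map (φ i) (ψ k) t) = 0) : t = 0 := by
  refine eq_zero_of_lTensor ψ hψ t fun k => hφ _ fun i => ?_
  rw [← ht i k]
  generalize t = t
  induction t with
  | zero => simp
  | add s t hs ht => simp only [map_add, hs, ht]
  | tmul v w => simp [mul_comm]

end Aux

/-! ### The Nichols algebras `U_q(n⁺)` and `U_q(n⁻)` -/

/-- The right radical of the pairing of the tensor algebras. -/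
def radPlus : Ideal (T F I) where
  carrier := {x | ∀ c, evT q X c x = 0}
  add_mem' hx hy c := by rw [map_add, hx c, hy c, add_zero]
  zero_mem' c := map_zero _
  smul_mem' y x hx c := evT_mul_right_eq_zero q X c x hx y

/-- The left radical of the pairing of the tensor algebras. -/
def radMinus : Ideal (T F I) where
  carrier := {c | ∀ b, evT q X c b = 0}
  add_mem' hx hy b := by rw [map_add, LinearMap.add_apply, hx b, hy b, add_zero]
  zero_mem' b := by rw [map_zero, LinearMap.zero_apply]
  smul_mem' y c hc b := by
    have : evT q X c = 0 := LinearMap.ext hc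
    rw [smul_eq_mul, evT_mul, this, TensorProduct.map_zero_left, LinearMap.zero_apply, map_zero]

instance : (radPlus q X).IsTwoSided where
  mul_mem_of_left y hx c := evT_mul_left_eq_zero q X c _ hx y

instance : (radMinus q X).IsTwoSided where
  mul_mem_of_left y hc b := by
    have : evT q X _ = 0 := LinearMap.ext hc
    rw [evT_mul, this, TensorProduct.map_zero_right, LinearMap.zero_apply, map_zero]

/-- `U_q(n⁺)`, the Nichols algebra of `E`: the quotient of the tensor algebra by the radical of
the pairing. -/
def UPlus := T F I ⧸ radPlus q X

instance : Ring (UPlus q X) := inferInstanceAs (Ring (T F I ⧸ radPlus q X))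

instance : Algebra F (UPlus q X) := inferInstanceAs (Algebra F (T F I ⧸ radPlus q X))

/-- `U_q(n⁻)`, the Nichols algebra of `F`: the quotient of the tensor algebra by the radical of
the pairing. -/
def UMinus := T F I ⧸ radMinus q X

instance : Ring (UMinus q X) := inferInstanceAs (Ring (T F I ⧸ radMinus q X))

instance : Algebra F (UMinus q X) := inferInstanceAs (Algebra F (T F I ⧸ radMinus q X))

/-- The projection of the tensor algebra of `E` onto `U_q(n⁺)`. -/
def projPlus : T F I →ₐ[F] UPlus q X := Ideal.Quotient.mkₐ F (radPlus q X)

/-- The projection of the tensor algebra of `F` onto `U_q(n⁻)`. -/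
def projMinus : T F I →ₐ[F] UMinus q X := Ideal.Quotient.mkₐ F (radMinus q X)

/-- The linear map induced on `U_q(n⁺)`. -/
def descendPlus {M : Type*} [AddCommGroup M] [Module F M]
    (f : T F I →ₗ[F] M) (hf : ∀ x, (∀ c, evT q X c x = 0) → f x = 0) : UPlus q X →ₗ[F] M where
  toFun := QuotientAddGroup.lift (radPlus q X).toAddSubgroup f.toAddMonoidHom hf
  map_add' x y := map_add (QuotientAddGroup.lift (radPlus q X).toAddSubgroup _ _) x y
  map_smul' r x := by
    obtain ⟨x, rfl⟩ := Ideal.Quotient.mk_surjective x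
    exact map_smul f r x

/-- The linear map induced on `U_q(n⁻)`. -/
def descendMinus {M : Type*} [AddCommGroup M] [Module F M]
    (f : T F I →ₗ[F] M) (hf : ∀ x, (∀ b, evT q X x b = 0) → f x = 0) : UMinus q X →ₗ[F] M where
  toFun := QuotientAddGroup.lift (radMinus q X).toAddSubgroup f.toAddMonoidHom hf
  map_add' x y := map_add (QuotientAddGroup.lift (radMinus q X).toAddSubgroup _ _) x y
  map_smul' r x := by
    obtain ⟨x, rfl⟩ := Ideal.Quotient.mk_surjective x
    exact map_smul f r x

lemma descendPlus_mk {M : Type*} [AddCommGroup M] [Module F M]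
    (f : T F I →ₗ[F] M) (hf : ∀ x, (∀ c, evT q X c x = 0) → f x = 0) (x : T F I) :
    descendPlus q X f hf (projPlus q X x) = f x := rfl

lemma descendMinus_mk {M : Type*} [AddCommGroup M] [Module F M]
    (f : T F I →ₗ[F] M) (hf : ∀ x, (∀ b, evT q X x b = 0) → f x = 0) (x : T F I) :
    descendMinus q X f hf (projMinus q X x) = f x := rfl

/-- The pairing `ev` of `U_q(n⁻)` and `U_q(n⁺)`. -/
def ev : UMinus q X →ₗ[F] UPlus q X →ₗ[F] F :=
  descendMinus q X
    (LinearMap.flip <| descendPlus q X (evT q X).flip fun _ hx => LinearMap.ext hx)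
    fun _ hc => by
      refine LinearMap.ext fun b => ?_
      obtain ⟨b, rfl⟩ := Ideal.Quotient.mk_surjective b
      exact hc b

lemma ev_mk (c b : T F I) : ev q X (projMinus q X c) (projPlus q X b) = evT q X c b := rfl

lemma projPlus_surjective : Function.Surjective (projPlus q X) :=
  Ideal.Quotient.mk_surjective

lemma projMinus_surjective : Function.Surjective (projMinus q X) :=
  Ideal.Quotient.mk_surjective

lemma eq_zero_of_ev_left (b : UPlus q X) (hb : ∀ c, ev q X (projMinus q X c) b = 0) : b = 0 := by
  obtain ⟨b, rfl⟩ := Ideal.Quotient.mk_surjective b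
  exact Ideal.Quotient.eq_zero_iff_mem.mpr hb

lemma eq_zero_of_ev_right (c : UMinus q X)
    (hc : ∀ b, (ev q X).flip (projPlus q X b) c = 0) : c = 0 := by
  obtain ⟨c, rfl⟩ := Ideal.Quotient.mk_surjective c
  exact Ideal.Quotient.eq_zero_iff_mem.mpr hc

/-- The coproduct of `U_q(n⁺)`, induced from the tensor algebra. -/
def comulPlus : UPlus q X →ₗ[F] UPlus q X ⊗[F] UPlus q X :=
  descendPlus q X
    (TensorProduct.map (projPlus q X).toLinearMap (projPlus q X).toLinearMap ∘ₗ
      comulT q X (degE I))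
    fun x hx => by
      refine eq_zero_of_map _ (eq_zero_of_ev_left q X) _ (eq_zero_of_ev_left q X) _ fun c c' => ?_
      rw [LinearMap.comp_apply, ← LinearMap.comp_apply, ← TensorProduct.map_comp]
      exact (evT_mul q X c' c x).symm.trans (hx _)

/-- The coproduct of `U_q(n⁻)`, induced from the tensor algebra. -/
def comulMinus : UMinus q X →ₗ[F] UMinus q X ⊗[F] UMinus q X :=
  descendMinus q X
    (TensorProduct.map (projMinus q X).toLinearMap (projMinus q X).toLinearMap ∘ₗ
      comulT q X (degF I))
    fun x hx => by
      refine eq_zero_of_map _ (eq_zero_of_ev_right q X) _ (eq_zero_of_ev_right q X) _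
        fun b b' => ?_
      rw [comulT_degF, LinearMap.comp_apply, ← LinearMap.comp_apply, ← TensorProduct.map_comp]
      exact (evT_mul' q X x b' b).symm.trans (hx _)

/-- The counit of `U_q(n⁺)`. -/
def counitPlus : UPlus q X →ₗ[F] F :=
  descendPlus q X (counitT F I).toLinearMap fun x hx => (evT_one q X x).symm.trans (hx 1)

lemma evT_one_right (c : T F I) : evT q X c 1 = counitT F I c := by
  induction c using T_induct with
  | one => rw [evT_one]
  | gen_mul j c _ => rw [evT_gen_mul, skewDer_one, map_zero, counitT_gen_mul]
  | add a b ha hb => rw [map_add, LinearMap.add_apply, ha, hb, map_add]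
  | smul r a ha => rw [map_smul, LinearMap.smul_apply, ha, map_smul]

/-- The counit of `U_q(n⁻)`. -/
def counitMinus : UMinus q X →ₗ[F] F :=
  descendMinus q X (counitT F I).toLinearMap fun x hx => (evT_one_right q X x).symm.trans (hx 1)

/-- The `A`-coaction on `U_q(n⁺)`, with `e_i ↦ g_i ⊗ e_i`. -/
def coactPlus : UPlus q X →ₗ[F] Lat F I ⊗[F] UPlus q X :=
  descendPlus q X (LinearMap.lTensor _ (projPlus q X).toLinearMap ∘ₗ (coactT F (degE I)).toLinearMap)
    fun x hx => by
      refine eq_zero_of_lTensor _ (eq_zero_of_ev_left q X) _ fun c => ?_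
      rw [LinearMap.comp_apply, ← LinearMap.comp_apply, ← LinearMap.lTensor_comp]
      exact coactT_mem_radPlus q X c x hx

/-- The `A`-coaction on `U_q(n⁻)`, with `f_i ↦ g_i⁻¹ ⊗ f_i`. -/
def coactMinus : UMinus q X →ₗ[F] Lat F I ⊗[F] UMinus q X :=
  descendMinus q X (LinearMap.lTensor _ (projMinus q X).toLinearMap ∘ₗ (coactT F (degF I)).toLinearMap)
    fun x hx => by
      refine eq_zero_of_lTensor _ (eq_zero_of_ev_right q X) _ fun b => ?_
      rw [LinearMap.comp_apply, ← LinearMap.comp_apply, ← LinearMap.lTensor_comp]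
      have hx' : evT q X x = 0 := LinearMap.ext hx
      refine (coactT_degF q X x b).trans ?_
      rw [hx', LinearMap.lTensor_zero, LinearMap.zero_apply, map_zero, map_zero]

/-- The `H`-action `h ▷ b = ⟨h, b⁽⁻¹⁾⟩ b⁽⁰⁾` on `U_q(n⁺)`. -/
def actPlus : Lat F I →ₗ[F] UPlus q X →ₗ[F] UPlus q X :=
  TensorProduct.curry <| (TensorProduct.lid F _).toLinearMap ∘ₗ
    LinearMap.rTensor _ (TensorProduct.lift (pairing q X)) ∘ₗ
    (TensorProduct.assoc F _ _ _).symm.toLinearMap ∘ₗ LinearMap.lTensor _ (coactPlus q X)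

/-- The `H`-action `h ▷ c = ⟨h, c⁽⁻¹⁾⟩ c⁽⁰⁾` on `U_q(n⁻)`. -/
def actMinus : Lat F I →ₗ[F] UMinus q X →ₗ[F] UMinus q X :=
  TensorProduct.curry <| (TensorProduct.lid F _).toLinearMap ∘ₗ
    LinearMap.rTensor _ (TensorProduct.lift (pairing q X)) ∘ₗ
    (TensorProduct.assoc F _ _ _).symm.toLinearMap ∘ₗ LinearMap.lTensor _ (coactMinus q X)

/-- `b ↦ R̄⁻*(b⁽⁻¹⁾) ⊗ b⁽⁰⁾`. -/
def rCoactPlus : UPlus q X →ₗ[F] Lat F I ⊗[F] UPlus q X :=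
  LinearMap.rTensor _ (RbarInv F X) ∘ₗ coactPlus q X

/-- `c ↦ R⁻*(c⁽⁻¹⁾) ⊗ c⁽⁰⁾`. -/
def rCoactMinus : UMinus q X →ₗ[F] Lat F I ⊗[F] UMinus q X :=
  LinearMap.rTensor _ (Rinv F X) ∘ₗ coactMinus q X

/-! ### The braided Drinfeld double and the braided Heisenberg double -/

/-- The tensor algebra of `U_q(n⁻) ⊕ H ⊕ U_q(n⁺)`, from which both doubles are obtained by
imposing relations. -/
abbrev Free := TensorAlgebra F (UMinus q X × Lat F I × UPlus q X)

/-- The free generators from `C = U_q(n⁻)`. -/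
def jC : UMinus q X →ₗ[F] Free q X :=
  TensorAlgebra.ι F ∘ₗ LinearMap.inl F _ _

/-- The free generators from `H`. -/
def jH : Lat F I →ₗ[F] Free q X :=
  TensorAlgebra.ι F ∘ₗ LinearMap.inr F _ _ ∘ₗ LinearMap.inl F _ _

/-- The free generators from `B = U_q(n⁺)`. -/
def jB : UPlus q X →ₗ[F] Free q X :=
  TensorAlgebra.ι F ∘ₗ LinearMap.inr F _ _ ∘ₗ LinearMap.inr F _ _

/-- `(h₍₂₎ ▷ b) h₍₁₎`. -/
def smashPlus (h : Lat F I) (b : UPlus q X) : Free q X :=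
  LinearMap.mul' F _ (TensorProduct.map (jB q X ∘ₗ (actPlus q X).flip b) (jH q X)
    (TensorProduct.comm F _ _ (Coalgebra.comul (R := F) h)))

/-- `(h₍₂₎ ▷ c) h₍₁₎`. -/
def smashMinus (h : Lat F I) (c : UMinus q X) : Free q X :=
  LinearMap.mul' F _ (TensorProduct.map (jC q X ∘ₗ (actMinus q X).flip c) (jH q X)
    (TensorProduct.comm F _ _ (Coalgebra.comul (R := F) h)))

/-- The relations common to both doubles: `C`, `H`, `B` are mapped to the double by algebra
morphisms, `h b = (h₍₂₎ ▷ b) h₍₁₎` and `h c = (h₍₂₎ ▷ c) h₍₁₎`. -/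
inductive BaseRel : Free q X → Free q X → Prop
  | oneC : BaseRel (jC q X 1) 1
  | mulC (c c') : BaseRel (jC q X (c * c')) (jC q X c * jC q X c')
  | oneH : BaseRel (jH q X 1) 1
  | mulH (h h') : BaseRel (jH q X (h * h')) (jH q X h * jH q X h')
  | oneB : BaseRel (jB q X 1) 1
  | mulB (b b') : BaseRel (jB q X (b * b')) (jB q X b * jB q X b')
  | smashB (h b) : BaseRel (jH q X h * jB q X b) (smashPlus q X h b)
  | smashC (h c) : BaseRel (jH q X h * jC q X c) (smashMinus q X h c)

/-- `c₍₂₎ ⊗ b₍₁₎ ⊗ c₍₁₎ ⊗ b₍₂₎`. -/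
def splitCB (c : UMinus q X) (b : UPlus q X) :
    (UMinus q X ⊗[F] UPlus q X) ⊗[F] (UMinus q X ⊗[F] UPlus q X) :=
  TensorProduct.tensorTensorTensorComm F _ _ _ _
    (TensorProduct.comm F _ _ (comulMinus q X c) ⊗ₜ[F] comulPlus q X b)

/-- `c ⊗ b ↦ (R⁻*(c⁽⁻¹⁾) ▷ b) c⁽⁰⁾`. -/
def crossTerm : UMinus q X ⊗[F] UPlus q X →ₗ[F] Free q X :=
  LinearMap.mul' F _ ∘ₗ
    TensorProduct.map (jB q X ∘ₗ TensorProduct.lift (actPlus q X)) (jC q X) ∘ₗ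
    (TensorProduct.rightComm F _ _ _).toLinearMap ∘ₗ
    LinearMap.rTensor _ (rCoactMinus q X)

/-- `(R⁻*(c₍₁₎⁽⁻¹⁾) ▷ b₍₂₎) c₍₁₎⁽⁰⁾ ev(c₍₂₎, b₍₁₎)`. -/
def crossLeft (c : UMinus q X) (b : UPlus q X) : Free q X :=
  TensorProduct.lid F _
    (TensorProduct.map (TensorProduct.lift (ev q X)) (crossTerm q X) (splitCB q X c b))

/-- `c ⊗ b ↦ ev(c⁽⁰⁾, b⁽⁰⁾) R⁻*(c⁽⁻¹⁾) ⊗ R̄⁻*(b⁽⁻¹⁾)`. -/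
def evTwist : UMinus q X ⊗[F] UPlus q X →ₗ[F] Lat F I ⊗[F] Lat F I :=
  (TensorProduct.rid F _).toLinearMap ∘ₗ
    LinearMap.lTensor _ (TensorProduct.lift (ev q X)) ∘ₗ
    (TensorProduct.tensorTensorTensorComm F _ _ _ _).toLinearMap ∘ₗ
    TensorProduct.map (rCoactMinus q X) (rCoactPlus q X)

/-- `c ⊗ b ⊗ h ⊗ h' ↦ h c b h'`. -/
def wrap : (UMinus q X ⊗[F] UPlus q X) ⊗[F] (Lat F I ⊗[F] Lat F I) →ₗ[F] Free q X :=
  LinearMap.mul' F _ ∘ₗ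
    TensorProduct.map
      (LinearMap.mul' F _ ∘ₗ TensorProduct.map (jH q X) (jC q X) ∘ₗ
        (TensorProduct.comm F _ _).toLinearMap)
      (LinearMap.mul' F _ ∘ₗ TensorProduct.map (jB q X) (jH q X)) ∘ₗ
    (TensorProduct.tensorTensorTensorComm F _ _ _ _).toLinearMap

/-- `R⁻*(c₍₁₎⁽⁻¹⁾) c₍₂₎ b₍₁₎ R̄⁻*(b₍₂₎⁽⁻¹⁾) ev(c₍₁₎⁽⁰⁾, b₍₂₎⁽⁰⁾)`. -/
def crossRight (c : UMinus q X) (b : UPlus q X) : Free q X :=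
  wrap q X (LinearMap.lTensor _ (evTwist q X) (splitCB q X c b))

/-- The defining relations of the braided Drinfeld double. -/
inductive DrinRel : Free q X → Free q X → Prop
  | base {x y} : BaseRel q X x y → DrinRel x y
  | cross (c b) : DrinRel (crossLeft q X c b) (crossRight q X c b)

/-- The defining relations of the braided Heisenberg double. -/
inductive HeisRel : Free q X → Free q X → Prop
  | base {x y} : BaseRel q X x y → HeisRel x y
  | cross (c b) : HeisRel (jC q X c * jB q X b) (crossLeft q X c b)

/-- The braided Drinfeld double `Drin_H(U_q(n⁻), U_q(n⁺))`, as an algebra. -/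
def Drin := RingQuot (DrinRel q X)

instance : Ring (Drin q X) := inferInstanceAs (Ring (RingQuot (DrinRel q X)))

instance : Algebra F (Drin q X) := inferInstanceAs (Algebra F (RingQuot (DrinRel q X)))

/-- The quotient map from the free algebra. -/
def drinMk : Free q X →ₐ[F] Drin q X := RingQuot.mkAlgHom F (DrinRel q X)

/-- The braided Heisenberg double `Heis_H(U_q(n⁻), U_q(n⁺))`. -/
def Heis := RingQuot (HeisRel q X)

instance : Ring (Heis q X) := inferInstanceAs (Ring (RingQuot (HeisRel q X)))

instance : Algebra F (Heis q X) := inferInstanceAs (Algebra F (RingQuot (HeisRel q X)))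

/-- The quotient map from the free algebra. -/
def heisMk : Free q X →ₐ[F] Heis q X := RingQuot.mkAlgHom F (HeisRel q X)

/-- The canonical map `U_q(n⁻) → Drin`. -/
def drinC : UMinus q X →ₗ[F] Drin q X := (drinMk q X).toLinearMap ∘ₗ jC q X

/-- The canonical map `H → Drin`. -/
def drinH : Lat F I →ₗ[F] Drin q X := (drinMk q X).toLinearMap ∘ₗ jH q X

/-- The canonical map `U_q(n⁺) → Drin`. -/
def drinB : UPlus q X →ₗ[F] Drin q X := (drinMk q X).toLinearMap ∘ₗ jB q X

/-- The canonical map `U_q(n⁻) → Heis`. -/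
def heisC : UMinus q X →ₗ[F] Heis q X := (heisMk q X).toLinearMap ∘ₗ jC q X

/-- The canonical map `H → Heis`. -/
def heisH : Lat F I →ₗ[F] Heis q X := (heisMk q X).toLinearMap ∘ₗ jH q X

/-- The canonical map `U_q(n⁺) → Heis`. -/
def heisB : UPlus q X →ₗ[F] Heis q X := (heisMk q X).toLinearMap ∘ₗ jB q X

/-! ### The coproduct and the coaction -/

section Delta

variable {D : Type*} [Ring D] [Algebra F D]

/-- `b ↦ b₍₁₎ R̄⁻*(b₍₂₎⁽⁻¹⁾) ⊗ b₍₂₎⁽⁰⁾ ∈ Drin ⊗ D`, for a given map `U_q(n⁺) → D`. -/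
def deltaB (β : UPlus q X →ₗ[F] D) : UPlus q X →ₗ[F] Drin q X ⊗[F] D :=
  LinearMap.mul' F _ ∘ₗ
    TensorProduct.map ((TensorProduct.mk F (Drin q X) D).flip 1 ∘ₗ drinB q X)
      (TensorProduct.map (drinH q X) β ∘ₗ rCoactPlus q X) ∘ₗ
    comulPlus q X

/-- `c ↦ R⁻*(c₍₁₎⁽⁻¹⁾) c₍₂₎ ⊗ c₍₁₎⁽⁰⁾ ∈ Drin ⊗ D`, for a given map `U_q(n⁻) → D`. -/
def deltaC (γ : UMinus q X →ₗ[F] D) : UMinus q X →ₗ[F] Drin q X ⊗[F] D :=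
  LinearMap.mul' F _ ∘ₗ
    TensorProduct.map (TensorProduct.map (drinH q X) γ ∘ₗ rCoactMinus q X)
      ((TensorProduct.mk F (Drin q X) D).flip 1 ∘ₗ drinC q X) ∘ₗ
    comulMinus q X

/-- `h ↦ h₍₂₎ ⊗ h₍₁₎ ∈ Drin ⊗ D`, for a given map `H → D`. -/
def deltaH (η : Lat F I →ₗ[F] D) : Lat F I →ₗ[F] Drin q X ⊗[F] D :=
  TensorProduct.map (drinH q X) η ∘ₗ (TensorProduct.comm F _ _).toLinearMap ∘ₗ
    Coalgebra.comul

end Delta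

/-! ### Bialgebras, comodule algebras, and the specialization to the field `k(q)` -/

/-- The algebra morphisms `Δ` and `ε` make the algebra `U` a bialgebra. -/
structure IsBialgebra {U : Type*} [Ring U] [Algebra F U] (Δ : U →ₐ[F] U ⊗[F] U) (ε : U →ₐ[F] F) :
    Prop where
  coassoc : ∀ u, Algebra.TensorProduct.assoc F F F U U U
      (Algebra.TensorProduct.map Δ (AlgHom.id F U) (Δ u)) =
    Algebra.TensorProduct.map (AlgHom.id F U) Δ (Δ u)
  counit_left : ∀ u, Algebra.TensorProduct.map ε (AlgHom.id F U) (Δ u) = 1 ⊗ₜ[F] u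
  counit_right : ∀ u, Algebra.TensorProduct.map (AlgHom.id F U) ε (Δ u) = u ⊗ₜ[F] 1

/-- The algebra morphism `δ` makes the algebra `D` a left comodule algebra over the bialgebra `U`
with coproduct `Δ` and counit `ε`. -/
structure IsLeftComoduleAlgebra {U D : Type*} [Ring U] [Algebra F U] [Ring D] [Algebra F D]
    (Δ : U →ₐ[F] U ⊗[F] U) (ε : U →ₐ[F] F) (δ : D →ₐ[F] U ⊗[F] D) : Prop where
  coassoc : ∀ x, Algebra.TensorProduct.assoc F F F U U D
      (Algebra.TensorProduct.map Δ (AlgHom.id F D) (δ x)) =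
    Algebra.TensorProduct.map (AlgHom.id F U) δ (δ x)
  counit : ∀ x, Algebra.TensorProduct.map ε (AlgHom.id F D) (δ x) = 1 ⊗ₜ[F] x

/-- The variable `q` of the field `k(q)`. -/
def qVar (k : Type*) [Field k] : (RatFunc k)ˣ := Units.mk0 RatFunc.X RatFunc.X_ne_zero

/-- The quantum group `U_q(g)`, realized as the braided Drinfeld double. -/
abbrev Uq (k : Type*) [Field k] {I : Type*} (X : CartanDatum I) := Drin (qVar k) X

/-- The quantum Weyl algebra `D_q(g)`, defined as the braided Heisenberg double. -/
abbrev Dq (k : Type*) [Field k] {I : Type*} (X : CartanDatum I) := Heis (qVar k) X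

end QuantumWeyl

end

noncomputable section

namespace QuantumWeyl

variable {F : Type*} [Field F] (q : Fˣ) {I : Type*} (X : CartanDatum I)

/-! ### Homogeneous elements of the tensor algebra -/

/-! Write `k_j` for `K_j ^ (j · j / 2)` and `c_ij` for `⟨f_j, e_i⟩`, which vanishes unless `i = j`.
The argument rests on a presentation of both doubles in which only relations between generators are
imposed: `K_κ e_i = q^⟨κ,i⟩ e_i K_κ`, `f_i K_κ = q^⟨κ,i⟩ K_κ f_i`, `f_j e_i + z c_ij k_j² = q^(i·j)
e_i f_j + c_ij`. The scalar `z` is `1` for the Drinfeld double and `0` for the Heisenberg double;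
`Rep q X z A` records algebra morphisms from `C`, `H`, `B` to `A` with these relations.

That they imply the relations for all `b` and `c` is the main point. Let `∂_j` and `∂'_j` be the
derivations `skewDer` and `skewDerL`, which pair `f_j` with the second and the first leg of the
coproduct. Moving `f_j` through the image of `x ∈ T(E)` gives `f_j x + z k_j ∂_j(x) k_j = tw_j(x)
f_j + ∂'_j(x)` (`Rep.f_gen_mul_e`). Let `L(c, b)` and `S(c, b)` be the images of `crossLeft` and
`crossRight`. It follows that `L(f_j c, b) = f_j L(c, b) + z k_j L(c, ∂_j b) k_j`, whereas always
`S(f_j c, b) = f_j S(c, b) + k_j S(c, ∂_j b) k_j`, and both are `b` at `c = 1`. For `z = 1` the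
recursions agree, so `L = S`; for `z = 0` the first one says `L(c, b) = c b`. These are the two
cross relations, and `Rep.drinLift`, `Rep.heisLift` follow.

The coproduct and the coaction are one construction: for every `σ : Rep q X z D` the formulas of the
theorem define an element `Rep.delta` of `Rep q X z (Drin ⊗ D)`. They are multiplicative on `B`
because they turn left multiplication by `e_i` on the braided coproduct into left multiplication by
`e_i ⊗ 1 + k_i ⊗ e_i`, and similarly on `C`; nothing about the radicals has to be checked, since the
formulas already live on the quotients. In the cross relation the term `-c_ij k_j² ⊗ 1` from the
first factor cancels `c_ij k_j k_i ⊗ 1` from the second, which leaves `c_ij (1 ⊗ 1 - z k_j² ⊗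
k_j²)`: the parameter of `D` is inherited. Taking `D = Drin` gives `Δ`, and `D = Heis` gives `δ`.
The axioms are equalities of algebra morphisms, so they need only be checked on `e_i`, `f_i`, `K_κ`.
-/

/-- The homogeneous elements of the tensor algebra, graded by the lattice with the generator `i`
in degree `i`. -/
inductive IsHom : (I →₀ ℤ) → T F I → Prop
  | zero (μ) : IsHom μ 0
  | one : IsHom 0 1
  | gen_mul (i) {μ y} : IsHom μ y → IsHom (Finsupp.single i 1 + μ) (gen i * y)
  | add {μ x y} : IsHom μ x → IsHom μ y → IsHom μ (x + y)
  | smul (r : F) {μ y} : IsHom μ y → IsHom μ (r • y)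

lemma IsHom.gen (i : I) : IsHom (Finsupp.single i 1) (gen i : T F I) := by
  simpa using IsHom.gen_mul (F := F) i IsHom.one

lemma mem_closure_isHom (x : T F I) :
    x ∈ AddSubmonoid.closure {y : T F I | ∃ μ, IsHom μ y} := by
  induction x using T_induct with
  | one => exact AddSubmonoid.subset_closure ⟨0, .one⟩
  | gen_mul i y h =>
    induction h using AddSubmonoid.closure_induction with
    | mem y hy =>
      obtain ⟨μ, hy⟩ := hy
      exact AddSubmonoid.subset_closure ⟨_, hy.gen_mul i⟩
    | zero => rw [mul_zero]; exact zero_mem _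
    | add x y _ _ hx hy => rw [mul_add]; exact add_mem hx hy
  | add x y hx hy => exact add_mem hx hy
  | smul r y h =>
    induction h using AddSubmonoid.closure_induction with
    | mem y hy =>
      obtain ⟨μ, hy⟩ := hy
      exact AddSubmonoid.subset_closure ⟨μ, hy.smul r⟩
    | zero => rw [smul_zero]; exact zero_mem _
    | add x y _ _ hx hy => rw [smul_add]; exact add_mem hx hy

/-- On homogeneous elements the coactions become monomials and the twists become powers of `q`, so
additive identities are checked there. No case for zero is required, because `0` is homogeneous of
every degree. -/
lemma hom_induct {P : T F I → Prop} (hom : ∀ μ x, IsHom μ x → P x)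
    (add : ∀ x y, P x → P y → P (x + y)) (x : T F I) : P x := by
  induction mem_closure_isHom x using AddSubmonoid.closure_induction with
  | mem y hy => exact hom _ _ hy.choose_spec
  | zero => exact hom 0 0 (.zero 0)
  | add x y _ _ hx hy => exact add x y hx hy

lemma hom_induct₂ {P : T F I ⊗[F] T F I → Prop}
    (hom : ∀ μ x ν y, IsHom μ x → IsHom ν y → P (x ⊗ₜ[F] y))
    (add : ∀ x y, P x → P y → P (x + y)) (t : T F I ⊗[F] T F I) : P t := by
  induction t with
  | zero =>
    rw [← TensorProduct.zero_tmul (T F I) (0 : T F I)]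
    exact hom 0 0 0 0 (.zero 0) (.zero 0)
  | add s t hs ht => exact add s t hs ht
  | tmul x y =>
    induction x using hom_induct with
    | hom μ x hx =>
      induction y using hom_induct with
      | hom ν y hy => exact hom μ x ν y hx hy
      | add y z hy hz => rw [TensorProduct.tmul_add]; exact add _ _ hy hz
    | add x z hx hz => rw [TensorProduct.add_tmul]; exact add _ _ hx hz

lemma mon_mul_mon (μ ν : I →₀ ℤ) : mon F μ * mon F ν = mon F (μ + ν) := by
  simp [mon]

namespace IsHom

/-- `D` is the additive extension of `d`: the identity for `E` and its negative for `F`. One grading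
thus serves both tensor algebras, with `f_i` also in degree `i` and the sign confined to the
coaction. -/
lemma coact {d : I → I →₀ ℤ} (D : (I →₀ ℤ) →+ (I →₀ ℤ)) (hD : ∀ i, D (Finsupp.single i 1) = d i)
    {μ : I →₀ ℤ} {x : T F I} (h : IsHom μ x) : coactT F d x = mon F (D μ) ⊗ₜ[F] x := by
  induction h with
  | zero => simp
  | one => rw [map_one, map_zero]; rfl
  | gen_mul i h ih =>
    rw [coactT_gen_mul, ih, Algebra.TensorProduct.tmul_mul_tmul, mon_mul_mon, map_add, hD]
  | add _ _ hx hy => rw [map_add, hx, hy, TensorProduct.tmul_add]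
  | smul r _ h => rw [map_smul, h, TensorProduct.tmul_smul]

lemma coact_degE {μ : I →₀ ℤ} {x : T F I} (h : IsHom μ x) :
    coactT F (degE I) x = mon F μ ⊗ₜ[F] x :=
  h.coact (AddMonoidHom.id _) fun _ => rfl

lemma coact_degF {μ : I →₀ ℤ} {x : T F I} (h : IsHom μ x) :
    coactT F (degF I) x = mon F (-μ) ⊗ₜ[F] x :=
  h.coact (-AddMonoidHom.id _) fun _ => rfl

lemma tw_eq (i : I) {μ : I →₀ ℤ} {x : T F I} (h : IsHom μ x) :
    tw q X i x = ((q ^ X.form (Finsupp.single i 1) μ : Fˣ) : F) • x := by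
  induction h with
  | zero => simp
  | one => simp
  | gen_mul j h ih =>
    rw [tw_gen_mul, ih, map_add, zpow_add, mul_smul_comm, smul_smul, Units.val_mul]
    rfl
  | add _ _ hx hy => rw [map_add, hx, hy, smul_add]
  | smul r _ h => rw [map_smul, h, smul_comm]

lemma tw (i : I) {μ : I →₀ ℤ} {x : T F I} (h : IsHom μ x) : IsHom μ (tw q X i x) := by
  rw [h.tw_eq]
  exact h.smul _

lemma skewDer (j : I) {μ : I →₀ ℤ} {x : T F I} (h : IsHom μ x) :
    IsHom (μ - Finsupp.single j 1) (skewDer q X j x) := by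
  induction h with
  | zero => rw [map_zero]; exact .zero _
  | one => rw [skewDer_one]; exact .zero _
  | gen_mul i h ih =>
    rw [skewDer_gen_mul]
    refine .add ?_ ?_
    · rw [add_sub_assoc]
      exact ih.gen_mul i
    · by_cases hij : i = j
      · subst hij
        rw [add_sub_cancel_left]
        exact (h.tw q X i).smul _
      · rw [cf, if_neg hij, zero_smul]
        exact .zero _
  | add _ _ hx hy => rw [map_add]; exact hx.add hy
  | smul r _ h => rw [map_smul]; exact h.smul r

/-- A nonzero counit forces degree `0`. Carrying the counit as a scalar avoids that case
distinction. -/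
lemma counit_smul {M : Type*} [AddCommGroup M] [Module F M] (f : (I →₀ ℤ) → M)
    {μ : I →₀ ℤ} {x : T F I} (h : IsHom μ x) :
    counitT F I x • f μ = counitT F I x • f 0 := by
  induction h with
  | zero => simp
  | one => rfl
  | gen_mul i h ih => rw [counitT_gen_mul, zero_smul, zero_smul]
  | add _ _ hx hy => rw [map_add, add_smul, add_smul, hx, hy]
  | smul r _ h => rw [map_smul, smul_assoc, smul_assoc, h]

end IsHom

/-! ### Left skew derivations -/

lemma counitT_comulT_left (x : T F I) :
    TensorProduct.lid F _ (LinearMap.rTensor _ (counitT F I).toLinearMap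
      (comulT q X (degE I) x)) = x := by
  induction x using T_induct with
  | one => simp [comulT_one]
  | gen_mul i y h =>
    rw [comulT_gen_mul q X _ (form_degE X)]
    nth_rewrite 2 [← h]
    generalize comulT q X (degE I) y = t
    induction t with
    | zero => simp
    | add s t hs ht => simp only [map_add, hs, ht, mul_add]
    | tmul a b => simp [opL_tmul, counitT_gen_mul, counitT_tw]
  | add x y hx hy => simp only [map_add, hx, hy]
  | smul r y hy => simp only [map_smul, hy]

/-- The functional `⟨f_j, -⟩` sees only the multiples of `e_j`, on which `tw_i` is the scalar
`q^(i·j)`. -/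
lemma pairGen_tw (i j : I) (x : T F I) :
    pairGen q X j (tw q X i x) = ((q ^ X.dot i j : Fˣ) : F) * pairGen q X j x := by
  induction x using T_induct with
  | one => simp [pairGen_one]
  | gen_mul k y h =>
    rw [tw_gen_mul, map_smul, pairGen_gen_mul, pairGen_gen_mul, counitT_tw]
    by_cases hk : k = j
    · subst hk
      rfl
    · simp [cf, hk]
  | add x y hx hy => simp only [map_add, hx, hy, mul_add]
  | smul r y hy => simp only [map_smul, hy, smul_eq_mul, mul_left_comm]

/-- The map `b ↦ ⟨f_j, b₍₁₎⟩ b₍₂₎` on the tensor algebra of `E`. -/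
def skewDerL (j : I) : T F I →ₗ[F] T F I :=
  (TensorProduct.lid F _).toLinearMap ∘ₗ LinearMap.rTensor _ (pairGen q X j) ∘ₗ
    comulT q X (degE I)

lemma skewDerL_one (j : I) : skewDerL q X j (1 : T F I) = 0 := by
  simp [skewDerL, comulT_one, pairGen_one]

/-- Mirror image of `skewDer_gen_mul`: the braiding twists the first leg, which is now the one
paired with `f_j`. The twist therefore becomes a scalar on the derivative term, and the term with
`cf` is left untwisted. -/
lemma skewDerL_gen_mul (i j : I) (y : T F I) :
    skewDerL q X j (gen i * y) =
      ((q ^ X.dot i j : Fˣ) : F) • (gen i * skewDerL q X j y) + cf q X j i • y := by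
  nth_rewrite 3 [← counitT_comulT_left q X y]
  simp only [skewDerL, LinearMap.comp_apply, comulT_gen_mul q X _ (form_degE X)]
  generalize comulT q X (degE I) y = t
  induction t with
  | zero => simp
  | add s t hs ht =>
    simp only [map_add, hs, ht, mul_add, smul_add]
    abel
  | tmul a b =>
    simp [opL_tmul, pairGen_gen_mul, pairGen_tw, smul_smul, add_comm]

lemma IsHom.skewDerL (j : I) {μ : I →₀ ℤ} {x : T F I} (h : IsHom μ x) :
    IsHom (μ - Finsupp.single j 1) (skewDerL q X j x) := by
  induction h with
  | zero => rw [map_zero]; exact .zero _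
  | one => rw [skewDerL_one]; exact .zero _
  | gen_mul i h ih =>
    rw [skewDerL_gen_mul]
    refine .add ?_ ?_
    · rw [add_sub_assoc]
      exact (ih.gen_mul i).smul _
    · by_cases hij : i = j
      · subst hij
        rw [add_sub_cancel_left]
        exact h.smul _
      · rw [cf, if_neg hij, zero_smul]
        exact .zero _
  | add _ _ hx hy => rw [map_add]; exact hx.add hy
  | smul r _ h => rw [map_smul]; exact h.smul r

/-- This is coassociativity with `f_j` paired into the middle leg: both sides are `x₍₁₎ ⟨f_j, x₍₂₎⟩
⊗ x₍₃₎`. The proof shows that both satisfy the same recursion under left multiplication by a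
generator. -/
lemma rTensor_skewDer_comulT (j : I) (x : T F I) :
    LinearMap.rTensor _ (skewDer q X j) (comulT q X (degE I) x) =
      LinearMap.lTensor _ (skewDerL q X j) (comulT q X (degE I) x) := by
  induction x using T_induct with
  | one => simp [comulT_one, skewDer_one, skewDerL_one]
  | gen_mul i y h =>
    rw [comulT_gen_mul q X _ (form_degE X)]
    -- `S` is `opL` with its second summand scaled by `q^(i·j)`, the factor for moving `e_i` past
    -- the middle leg that is consumed by `f_j`.
    let S : T F I ⊗[F] T F I →ₗ[F] T F I ⊗[F] T F I :=
      TensorProduct.map (LinearMap.mulLeft F (gen i)) LinearMap.id +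
        ((q ^ X.dot i j : Fˣ) : F) •
          TensorProduct.map (tw q X i).toLinearMap (LinearMap.mulLeft F (gen i))
    have key : ∀ t, LinearMap.rTensor _ (skewDer q X j) (opL q X i t) =
        S (LinearMap.rTensor _ (skewDer q X j) t) +
        cf q X j i • LinearMap.rTensor _ (tw q X i).toLinearMap t := by
      intro t
      induction t with
      | zero => simp
      | add s t hs ht =>
        simp only [map_add, hs, ht, smul_add]
        abel
      | tmul a b =>
        simp [S, opL_tmul, skewDer_gen_mul, skewDer_tw, TensorProduct.add_tmul,
          TensorProduct.smul_tmul']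
        abel
    have key' : ∀ t, LinearMap.lTensor _ (skewDerL q X j) (opL q X i t) =
        S (LinearMap.lTensor _ (skewDerL q X j) t) +
        cf q X j i • LinearMap.rTensor _ (tw q X i).toLinearMap t := by
      intro t
      induction t with
      | zero => simp
      | add s t hs ht =>
        simp only [map_add, hs, ht, smul_add]
        abel
      | tmul a b =>
        simp [S, opL_tmul, skewDerL_gen_mul, TensorProduct.tmul_add, add_assoc]
    rw [key, key', h]
  | add x y hx hy => simp only [map_add, hx, hy]
  | smul r y hy => simp only [map_smul, hy]

/-! ### Homogeneous elements of the Nichols algebras -/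

lemma coactPlus_mk {μ : I →₀ ℤ} {x : T F I} (h : IsHom μ x) :
    coactPlus q X (projPlus q X x) = mon F μ ⊗ₜ[F] projPlus q X x := by
  refine (descendPlus_mk q X _ _ x).trans ?_
  rw [LinearMap.comp_apply, AlgHom.toLinearMap_apply, h.coact_degE]
  rfl

lemma coactMinus_mk {μ : I →₀ ℤ} {x : T F I} (h : IsHom μ x) :
    coactMinus q X (projMinus q X x) = mon F (-μ) ⊗ₜ[F] projMinus q X x := by
  refine (descendMinus_mk q X _ _ x).trans ?_
  rw [LinearMap.comp_apply, AlgHom.toLinearMap_apply, h.coact_degF]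
  rfl

lemma actPlus_mk (κ : I →₀ ℤ) {μ : I →₀ ℤ} {x : T F I} (h : IsHom μ x) :
    actPlus q X (mon F κ) (projPlus q X x) =
      ((q ^ X.cartanForm κ μ : Fˣ) : F) • projPlus q X x := by
  simp only [actPlus, TensorProduct.curry_apply, LinearMap.comp_apply, LinearMap.lTensor_tmul,
    coactPlus_mk q X h, LinearEquiv.coe_coe, TensorProduct.assoc_symm_tmul,
    LinearMap.rTensor_tmul, TensorProduct.lift.tmul, pairing_mon, TensorProduct.lid_tmul]

lemma actMinus_mk (κ : I →₀ ℤ) {μ : I →₀ ℤ} {x : T F I} (h : IsHom μ x) :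
    actMinus q X (mon F κ) (projMinus q X x) =
      ((q ^ (-X.cartanForm κ μ) : Fˣ) : F) • projMinus q X x := by
  simp only [actMinus, TensorProduct.curry_apply, LinearMap.comp_apply, LinearMap.lTensor_tmul,
    coactMinus_mk q X h, LinearEquiv.coe_coe, TensorProduct.assoc_symm_tmul,
    LinearMap.rTensor_tmul, TensorProduct.lift.tmul, pairing_mon, TensorProduct.lid_tmul, map_neg]

lemma rCoactPlus_mk {μ : I →₀ ℤ} {x : T F I} (h : IsHom μ x) :
    rCoactPlus q X (projPlus q X x) = mon F (X.half μ) ⊗ₜ[F] projPlus q X x := by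
  simp only [rCoactPlus, LinearMap.comp_apply, coactPlus_mk q X h, LinearMap.rTensor_tmul,
    RbarInv_mon]

lemma rCoactMinus_mk {μ : I →₀ ℤ} {x : T F I} (h : IsHom μ x) :
    rCoactMinus q X (projMinus q X x) = mon F (X.half μ) ⊗ₜ[F] projMinus q X x := by
  simp only [rCoactMinus, LinearMap.comp_apply, coactMinus_mk q X h, LinearMap.rTensor_tmul,
    Rinv_mon, map_neg, neg_neg]

lemma comulPlus_mk (x : T F I) : comulPlus q X (projPlus q X x) =
    TensorProduct.map (projPlus q X).toLinearMap (projPlus q X).toLinearMap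
      (comulT q X (degE I) x) := rfl

lemma comulMinus_mk (x : T F I) : comulMinus q X (projMinus q X x) =
    TensorProduct.map (projMinus q X).toLinearMap (projMinus q X).toLinearMap
      (comulT q X (degE I) x) := by
  rw [← comulT_degF]
  rfl

/-! ### The cross relations in the free algebra -/

/-- The coaction on `c` yields `g_{-μ}`, which `R⁻*` turns into `K_{half μ}`; by `cartanForm_half`
this acts on degree `ν` as `q^(μ·ν)`. -/
lemma crossTerm_mk {μ ν : I →₀ ℤ} {c b : T F I} (hc : IsHom μ c) (hb : IsHom ν b) :
    crossTerm q X (projMinus q X c ⊗ₜ[F] projPlus q X b) =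
      ((q ^ X.form μ ν : Fˣ) : F) • (jB q X (projPlus q X b) * jC q X (projMinus q X c)) := by
  simp only [crossTerm, LinearMap.comp_apply, LinearMap.rTensor_tmul, rCoactMinus_mk q X hc,
    LinearEquiv.coe_coe, TensorProduct.rightComm_tmul, TensorProduct.map_tmul,
    TensorProduct.lift.tmul, actPlus_mk q X _ hb, X.cartanForm_half, map_smul,
    LinearMap.mul'_apply, smul_mul_assoc]

/-- The left-hand side of the cross relation, as a function of the coproducts of representatives
in the tensor algebras. -/
def crossLeftMap : T F I ⊗[F] T F I →ₗ[F] T F I ⊗[F] T F I →ₗ[F] Free q X :=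
  TensorProduct.curry <| (TensorProduct.lid F _).toLinearMap ∘ₗ
    TensorProduct.map (TensorProduct.lift (ev q X)) (crossTerm q X) ∘ₗ
    (TensorProduct.tensorTensorTensorComm F _ _ _ _).toLinearMap ∘ₗ
    TensorProduct.map
      ((TensorProduct.comm F _ _).toLinearMap ∘ₗ
        TensorProduct.map (projMinus q X).toLinearMap (projMinus q X).toLinearMap)
      (TensorProduct.map (projPlus q X).toLinearMap (projPlus q X).toLinearMap)

lemma crossLeft_mk (c b : T F I) : crossLeft q X (projMinus q X c) (projPlus q X b) =
    crossLeftMap q X (comulT q X (degE I) c) (comulT q X (degE I) b) := by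
  rw [crossLeft, splitCB, comulMinus_mk, comulPlus_mk]
  rfl

lemma crossLeftMap_tmul {μ ν : I →₀ ℤ} {c b : T F I} (hc : IsHom μ c) (hb : IsHom ν b)
    (c' b' : T F I) : crossLeftMap q X (c ⊗ₜ[F] c') (b' ⊗ₜ[F] b) =
      (evT q X c' b' * ((q ^ X.form μ ν : Fˣ) : F)) •
        (jB q X (projPlus q X b) * jC q X (projMinus q X c)) := by
  simp only [crossLeftMap, TensorProduct.curry_apply, LinearMap.comp_apply,
    TensorProduct.map_tmul, LinearEquiv.coe_coe, TensorProduct.comm_tmul, AlgHom.toLinearMap_apply,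
    TensorProduct.tensorTensorTensorComm_tmul, TensorProduct.lift.tmul, ev_mk,
    crossTerm_mk q X hc hb, TensorProduct.lid_tmul, mul_smul]

/-- The right-hand side of the cross relation, as a function of the coproducts of representatives
in the tensor algebras. -/
def crossRightMap : T F I ⊗[F] T F I →ₗ[F] T F I ⊗[F] T F I →ₗ[F] Free q X :=
  TensorProduct.curry <| wrap q X ∘ₗ LinearMap.lTensor _ (evTwist q X) ∘ₗ
    (TensorProduct.tensorTensorTensorComm F _ _ _ _).toLinearMap ∘ₗ
    TensorProduct.map
      ((TensorProduct.comm F _ _).toLinearMap ∘ₗ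
        TensorProduct.map (projMinus q X).toLinearMap (projMinus q X).toLinearMap)
      (TensorProduct.map (projPlus q X).toLinearMap (projPlus q X).toLinearMap)

lemma crossRight_mk (c b : T F I) : crossRight q X (projMinus q X c) (projPlus q X b) =
    crossRightMap q X (comulT q X (degE I) c) (comulT q X (degE I) b) := by
  rw [crossRight, splitCB, comulMinus_mk, comulPlus_mk]
  rfl

lemma crossRightMap_tmul {μ ν : I →₀ ℤ} {c b : T F I} (hc : IsHom μ c) (hb : IsHom ν b)
    (c' b' : T F I) : crossRightMap q X (c ⊗ₜ[F] c') (b' ⊗ₜ[F] b) =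
      evT q X c b • (jH q X (mon F (X.half μ)) * jC q X (projMinus q X c') *
        (jB q X (projPlus q X b') * jH q X (mon F (X.half ν)))) := by
  simp only [crossRightMap, TensorProduct.curry_apply, LinearMap.comp_apply,
    TensorProduct.map_tmul, LinearEquiv.coe_coe, TensorProduct.comm_tmul, AlgHom.toLinearMap_apply,
    TensorProduct.tensorTensorTensorComm_tmul, LinearMap.lTensor_tmul, evTwist,
    rCoactMinus_mk q X hc, rCoactPlus_mk q X hb, TensorProduct.lift.tmul, ev_mk,
    TensorProduct.rid_tmul, TensorProduct.tmul_smul, map_smul, wrap, LinearMap.mul'_apply]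

lemma comulT_gen (i : I) :
    comulT q X (degE I) (gen i) = gen i ⊗ₜ[F] 1 + 1 ⊗ₜ[F] gen i := by
  have := comulT_gen_mul q X _ (form_degE X) i 1
  rwa [comulT_one, opL_tmul, map_one, mul_one] at this

lemma evT_gen_gen (i j : I) : evT q X (gen j) (gen i) = cf q X j i := by
  have := evT_gen_mul q X j 1 (gen i * 1)
  rw [skewDer_gen_mul, skewDer_one] at this
  simpa [evT_one] using this

lemma evT_gen_one (j : I) : evT q X (gen j) 1 = 0 := by
  rw [evT_one_right]
  simpa using counitT_gen_mul (F := F) j 1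

lemma evT_one_gen (j : I) : evT q X 1 (gen j) = 0 := by
  rw [evT_one]
  simpa using counitT_gen_mul (F := F) j 1

lemma evT_one_one : evT q X (1 : T F I) 1 = 1 := by
  rw [evT_one, map_one]

/-- Of the four products of terms in `Δ(f_j)` and `Δ(e_i)`, the pairing keeps those that pair `1`
with `1` or `f_j` with `e_i`. The factors `jB 1` and `jC 1` stay because they are not yet identified
with `1` in the free algebra. -/
lemma crossLeft_gen (i j : I) :
    crossLeft q X (projMinus q X (gen j)) (projPlus q X (gen i)) =
      ((q ^ X.dot i j : Fˣ) : F) •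
        (jB q X (projPlus q X (gen i)) * jC q X (projMinus q X (gen j))) +
      cf q X j i • (jB q X 1 * jC q X 1) := by
  rw [crossLeft_mk, comulT_gen, comulT_gen]
  simp only [map_add, LinearMap.add_apply, crossLeftMap_tmul q X (.gen _) (.gen _),
    crossLeftMap_tmul q X .one (.gen _), crossLeftMap_tmul q X (.gen _) .one,
    crossLeftMap_tmul q X .one .one, evT_gen_gen, evT_gen_one, evT_one_gen, map_zero,
    LinearMap.zero_apply, zpow_zero, Units.val_one, zero_smul, zero_add, add_zero,
    mul_one, map_one, evT_one_one, one_mul]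
  rw [X.dot_comm, add_comm]
  rfl

lemma crossRight_gen (i j : I) :
    crossRight q X (projMinus q X (gen j)) (projPlus q X (gen i)) =
      jH q X 1 * jC q X (projMinus q X (gen j)) * (jB q X (projPlus q X (gen i)) * jH q X 1) +
      cf q X j i • (jH q X (mon F (X.half (Finsupp.single j 1))) * jC q X 1 *
        (jB q X 1 * jH q X (mon F (X.half (Finsupp.single i 1))))) := by
  rw [crossRight_mk, comulT_gen, comulT_gen]
  simp only [map_add, LinearMap.add_apply, crossRightMap_tmul q X (.gen _) (.gen _),
    crossRightMap_tmul q X .one (.gen _), crossRightMap_tmul q X (.gen _) .one,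
    crossRightMap_tmul q X .one .one, evT_gen_gen, evT_gen_one, evT_one_gen,
    zero_smul, zero_add, add_zero, map_one, evT_one_one, one_smul, map_zero]
  rfl

/-! ### Algebras with morphisms from `U_q(n⁻)`, `H` and `U_q(n⁺)` -/

/-- Algebra morphisms from `U_q(n⁻)`, `H` and `U_q(n⁺)` to `A` that satisfy the relations between
generators of the braided Drinfeld double, for `z = 1`, or of the braided Heisenberg double,
for `z = 0`. -/
structure Rep (z : F) (A : Type*) [Ring A] [Algebra F A] where
  γ : UMinus q X →ₐ[F] A
  η : Lat F I →ₐ[F] A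
  β : UPlus q X →ₐ[F] A
  commB : ∀ κ i, η (mon F κ) * β (projPlus q X (gen i)) =
    ((q ^ X.cartanForm κ (Finsupp.single i 1) : Fˣ) : F) •
      (β (projPlus q X (gen i)) * η (mon F κ))
  commC : ∀ κ i, γ (projMinus q X (gen i)) * η (mon F κ) =
    ((q ^ X.cartanForm κ (Finsupp.single i 1) : Fˣ) : F) •
      (η (mon F κ) * γ (projMinus q X (gen i)))
  cross : ∀ i j, γ (projMinus q X (gen j)) * β (projPlus q X (gen i)) +
      (z * cf q X j i) • (η (mon F (X.half (Finsupp.single j 1))) *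
        η (mon F (X.half (Finsupp.single j 1)))) =
    ((q ^ X.dot i j : Fˣ) : F) • (β (projPlus q X (gen i)) * γ (projMinus q X (gen j))) +
      cf q X j i • 1

namespace Rep

variable {q X} {z : F} {A : Type*} [Ring A] [Algebra F A] (ρ : Rep q X z A)

/-- The image of the tensor algebra of `E`. -/
def e : T F I →ₐ[F] A := ρ.β.comp (projPlus q X)

/-- The image of the tensor algebra of `F`. -/
def f : T F I →ₐ[F] A := ρ.γ.comp (projMinus q X)

/-- The image of `K_μ`. -/
def K (μ : I →₀ ℤ) : A := ρ.η (mon F μ)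

/-- The image of `K_i ^ (i · i / 2)`. -/
def k (i : I) : A := ρ.K (X.half (Finsupp.single i 1))

lemma K_zero : ρ.K 0 = 1 := map_one ρ.η

lemma K_add (μ ν : I →₀ ℤ) : ρ.K (μ + ν) = ρ.K μ * ρ.K ν := by
  rw [K, ← mon_mul_mon, map_mul]
  rfl

lemma K_mul_e (κ : I →₀ ℤ) {μ : I →₀ ℤ} {x : T F I} (h : IsHom μ x) :
    ρ.K κ * ρ.e x = ((q ^ X.cartanForm κ μ : Fˣ) : F) • (ρ.e x * ρ.K κ) := by
  induction h with
  | zero => simp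
  | one => simp
  | gen_mul i _ ih =>
    have := ρ.commB κ i
    change ρ.K κ * ρ.e (gen i) = _ • (ρ.e (gen i) * ρ.K κ) at this
    rw [map_mul, ← mul_assoc, this, smul_mul_assoc, mul_assoc, ih, mul_smul_comm, smul_smul,
      map_add, zpow_add, Units.val_mul, mul_assoc]
  | add _ _ hx hy => rw [map_add, mul_add, add_mul, smul_add, hx, hy]
  | smul r _ h => rw [map_smul, mul_smul_comm, smul_mul_assoc, h, smul_comm]

lemma f_mul_K (κ : I →₀ ℤ) {μ : I →₀ ℤ} {x : T F I} (h : IsHom μ x) :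
    ρ.f x * ρ.K κ = ((q ^ X.cartanForm κ μ : Fˣ) : F) • (ρ.K κ * ρ.f x) := by
  induction h with
  | zero => simp
  | one => simp
  | gen_mul i _ ih =>
    have := ρ.commC κ i
    change ρ.f (gen i) * ρ.K κ = _ • (ρ.K κ * ρ.f (gen i)) at this
    rw [map_mul, mul_assoc, ih, mul_smul_comm, ← mul_assoc, this, smul_mul_assoc, smul_smul,
      map_add, zpow_add, Units.val_mul, mul_assoc, mul_comm (Units.val _)]
  | add _ _ hx hy => rw [map_add, mul_add, add_mul, smul_add, hx, hy]
  | smul r _ h => rw [map_smul, mul_smul_comm, smul_mul_assoc, h, smul_comm]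

/-- `k_j` commutes with degree `μ` up to `q^(j·μ)`, which is precisely the scalar by which `tw_j`
acts. This is what makes the braiding inner. -/
lemma e_tw_mul_k (j : I) (x : T F I) : ρ.e (tw q X j x) * ρ.k j = ρ.k j * ρ.e x := by
  induction x using hom_induct with
  | hom μ x h => rw [k, ρ.K_mul_e _ h, X.cartanForm_half, h.tw_eq, map_smul, smul_mul_assoc]
  | add x y hx hy => simp only [map_add, add_mul, mul_add, hx, hy]

/-- The power of `q` here is inverse to the one produced by `tw_j` in degree `μ`; the two cancel in
`crossRightMap_opL` and `deltaCMap_opL`. -/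
lemma K_mul_f_gen_mul (j : I) (μ : I →₀ ℤ) (y : T F I) :
    ρ.K (X.half μ) * ρ.f (gen j * y) =
      ((q ^ (-X.form (Finsupp.single j 1) μ) : Fˣ) : F) •
        (ρ.f (gen j) * (ρ.K (X.half μ) * ρ.f y)) := by
  rw [map_mul, ← mul_assoc, ← mul_assoc, ρ.f_mul_K _ (.gen j), X.cartanForm_half, X.symm,
    smul_mul_assoc, smul_smul, ← Units.val_mul, ← zpow_add, neg_add_cancel, zpow_zero,
    Units.val_one, one_smul]

/-- Moving `f_j` through `e_i y`, the constant in the cross relation supplies the inhomogeneous term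
of `∂'_j`, and its `z`-term supplies that of `∂_j`, enclosed between two factors `k_j`. The rest is
the identity for `y` multiplied by `q^(i·j) e_i`. -/
lemma f_gen_mul_e (j : I) (x : T F I) :
    ρ.f (gen j) * ρ.e x + z • (ρ.k j * ρ.e (skewDer q X j x) * ρ.k j) =
      ρ.e (tw q X j x) * ρ.f (gen j) + ρ.e (skewDerL q X j x) := by
  induction x using T_induct with
  | one => simp [skewDer_one, skewDerL_one]
  | gen_mul i y h =>
    have hc : ρ.f (gen j) * ρ.e (gen i) + (z * cf q X j i) • (ρ.k j * ρ.k j) =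
      ((q ^ X.dot i j : Fˣ) : F) • (ρ.e (gen i) * ρ.f (gen j)) + cf q X j i • 1 := ρ.cross i j
    have hk := ρ.e_tw_mul_k j y
    have hk' : ρ.k j * ρ.e (gen i) =
        ((q ^ X.dot i j : Fˣ) : F) • (ρ.e (gen i) * ρ.k j) := by
      rw [k, ρ.K_mul_e _ (.gen i), X.cartanForm_half, X.dot_comm i j]
      rfl
    -- The Leibniz rule of `∂_j` twists by `tw_i`, while commuting past `k_j` twists by `tw_j`; the
    -- coefficient vanishes unless `i = j`.
    have hcf : cf q X j i • ρ.e (tw q X i y) = cf q X j i • ρ.e (tw q X j y) := by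
      by_cases hij : i = j
      · rw [hij]
      · simp [cf, hij]
    rw [map_mul, ← mul_assoc, eq_sub_of_add_eq hc, skewDer_gen_mul, skewDerL_gen_mul, tw_gen_mul,
      X.dot_comm j i]
    simp only [map_add, map_smul, map_mul, add_mul, mul_add, sub_mul, smul_mul_assoc,
      hcf, mul_smul_comm, one_mul]
    -- The inhomogeneous part `k_j tw_j(y) k_j` becomes `k_j² y`, the form in which the cross
    -- relation produces it.
    rw [mul_assoc (ρ.k j) (ρ.e _) (ρ.k j), hk, ← mul_assoc (ρ.k j) (ρ.e (gen i)), hk']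
    have h' := congrArg (fun a => ((q ^ X.dot i j : Fˣ) : F) • (ρ.e (gen i) * a)) h
    simp only [mul_add, mul_smul_comm, smul_add, smul_mul_assoc, mul_assoc] at h' ⊢
    linear_combination (norm := module) h'
  | add x y hx hy =>
    simp only [map_add, mul_add, add_mul, smul_add]
    linear_combination (norm := module) hx + hy
  | smul r y hy =>
    simp only [map_smul, mul_smul_comm, smul_mul_assoc]
    linear_combination (norm := module) r • hy

end Rep

/-! ### Smash relations on monomials, and morphisms out of the free algebra -/

lemma comul_mon (κ : I →₀ ℤ) :
    Coalgebra.comul (R := F) (mon F κ) = mon F κ ⊗ₜ[F] mon F κ := by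
  simp [mon]

lemma smashPlus_mon (κ : I →₀ ℤ) (b : UPlus q X) : smashPlus q X (mon F κ) b =
    jB q X (actPlus q X (mon F κ) b) * jH q X (mon F κ) := by
  simp only [smashPlus, comul_mon, TensorProduct.comm_tmul, TensorProduct.map_tmul,
    LinearMap.comp_apply, LinearMap.flip_apply, LinearMap.mul'_apply]

lemma smashMinus_mon (κ : I →₀ ℤ) (b : UMinus q X) : smashMinus q X (mon F κ) b =
    jC q X (actMinus q X (mon F κ) b) * jH q X (mon F κ) := by
  simp only [smashMinus, comul_mon, TensorProduct.comm_tmul, TensorProduct.map_tmul,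
    LinearMap.comp_apply, LinearMap.flip_apply, LinearMap.mul'_apply]

namespace Rep

variable {q X} {z : F} {A : Type*} [Ring A] [Algebra F A] (ρ : Rep q X z A)

/-- The morphism from the free algebra. -/
def φ : Free q X →ₐ[F] A :=
  TensorAlgebra.lift F (ρ.γ.toLinearMap.coprod (ρ.η.toLinearMap.coprod ρ.β.toLinearMap))

lemma φ_jC (c : UMinus q X) : ρ.φ (jC q X c) = ρ.γ c := by
  simp [φ, jC]

lemma φ_jH (h : Lat F I) : ρ.φ (jH q X h) = ρ.η h := by
  simp [φ, jH]

lemma φ_jB (b : UPlus q X) : ρ.φ (jB q X b) = ρ.β b := by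
  simp [φ, jB]

/-! ### Recursions for the two sides of the cross relation -/

lemma φ_crossLeftMap_tmul {μ ν : I →₀ ℤ} {c b : T F I} (hc : IsHom μ c) (hb : IsHom ν b)
    (c' b' : T F I) : ρ.φ (crossLeftMap q X (c ⊗ₜ[F] c') (b' ⊗ₜ[F] b)) =
      (evT q X c' b' * ((q ^ X.form μ ν : Fˣ) : F)) • (ρ.e b * ρ.f c) := by
  rw [crossLeftMap_tmul q X hc hb, map_smul, map_mul, φ_jB, φ_jC]
  rfl

lemma φ_crossRightMap_tmul {μ ν : I →₀ ℤ} {c b : T F I} (hc : IsHom μ c) (hb : IsHom ν b)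
    (c' b' : T F I) : ρ.φ (crossRightMap q X (c ⊗ₜ[F] c') (b' ⊗ₜ[F] b)) =
      evT q X c b • (ρ.K (X.half μ) * ρ.f c' * (ρ.e b' * ρ.K (X.half ν))) := by
  rw [crossRightMap_tmul q X hc hb, map_smul, map_mul, map_mul, map_mul, φ_jB, φ_jC, φ_jH, φ_jH]
  rfl

/-- This is `f_gen_mul_e` for the second leg of `s`, multiplied on the right by the first leg of `t`
and weighted by the pairing of the other legs. For arbitrary `s` the two terms with `tw_j` on `t`
differ; they agree when `s` is a coproduct, by `rTensor_skewDer_comulT`. -/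
lemma crossLeftMap_opL (j : I) (t s : T F I ⊗[F] T F I) :
    ρ.f (gen j) * ρ.φ (crossLeftMap q X t s) +
        z • (ρ.k j * ρ.φ (crossLeftMap q X t (LinearMap.lTensor _ (skewDer q X j) s)) * ρ.k j) +
        ρ.φ (crossLeftMap q X (LinearMap.rTensor _ (tw q X j).toLinearMap t)
          (LinearMap.rTensor _ (skewDer q X j) s)) =
      ρ.φ (crossLeftMap q X (opL q X j t) s) +
        ρ.φ (crossLeftMap q X (LinearMap.rTensor _ (tw q X j).toLinearMap t)
          (LinearMap.lTensor _ (skewDerL q X j) s)) := by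
  induction t using hom_induct₂ with
  | add t t' ht ht' =>
    simp only [map_add, LinearMap.add_apply, mul_add, add_mul, smul_add]
    linear_combination (norm := module) ht + ht'
  | hom μ c _ c' hc _ =>
    induction s using hom_induct₂ with
    | add s s' hs hs' =>
      simp only [map_add, mul_add, add_mul, smul_add] at hs hs' ⊢
      linear_combination (norm := module) hs + hs'
    | hom _ b' ν b _ hb =>
      have hk := ρ.f_mul_K (X.half (Finsupp.single j 1)) hc
      rw [X.cartanForm_half] at hk
      change ρ.f c * ρ.k j = _ • (ρ.k j * ρ.f c) at hk
      have h := congrArg (· * ρ.f c) (ρ.f_gen_mul_e j b)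
      rw [opL_tmul, map_add, LinearMap.add_apply, map_add]
      simp only [LinearMap.lTensor_tmul, LinearMap.rTensor_tmul, AlgHom.toLinearMap_apply,
        ρ.φ_crossLeftMap_tmul hc hb, ρ.φ_crossLeftMap_tmul hc (hb.skewDer q X j),
        ρ.φ_crossLeftMap_tmul (hc.tw q X j) hb,
        ρ.φ_crossLeftMap_tmul (hc.tw q X j) (hb.skewDerL q X j),
        ρ.φ_crossLeftMap_tmul (hc.gen_mul j) hb]
      simp only [evT_gen_mul, hc.tw_eq, hb.tw_eq, map_smul, map_mul, map_sub, map_add,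
        LinearMap.add_apply, zpow_sub, zpow_add, Units.val_mul,
        X.symm μ (Finsupp.single j 1)] at h ⊢
      simp only [mul_smul_comm, smul_mul_assoc, mul_assoc, hk, add_mul, smul_smul] at h ⊢
      generalize q ^ X.form (Finsupp.single j 1) μ = u at *
      generalize q ^ X.form (Finsupp.single j 1) ν = v at *
      generalize q ^ X.form μ ν = w at *
      -- Both derivations lower the degree of `b` by `j`, so `w` turns into `w u⁻¹`. This `u⁻¹`
      -- cancels the `u` from moving `k_j` past `c`, respectively from twisting `c`.
      linear_combination (norm := skip) (evT q X c' b' * (w : F)) • h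
      match_scalars <;> field_simp <;> ring

/-- The cross relation is not needed. If `f_j` falls in the leg paired with `b`, it acts there as
`∂_j`, and the shift of both degrees splits off a `k_j` on each side. If it falls in the other leg,
moving it to the front past `K_{half μ}` cancels the twist of `c`. -/
lemma crossRightMap_opL (j : I) (t s : T F I ⊗[F] T F I) :
    ρ.φ (crossRightMap q X (opL q X j t) s) = ρ.f (gen j) * ρ.φ (crossRightMap q X t s) +
      ρ.k j * ρ.φ (crossRightMap q X t (LinearMap.lTensor _ (skewDer q X j) s)) * ρ.k j := by
  induction t using hom_induct₂ with
  | add t t' ht ht' =>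
    simp only [map_add, LinearMap.add_apply, mul_add, add_mul]
    linear_combination (norm := module) ht + ht'
  | hom μ c _ c' hc _ =>
    induction s using hom_induct₂ with
    | add s s' hs hs' =>
      simp only [map_add, mul_add, add_mul] at hs hs' ⊢
      linear_combination (norm := module) hs + hs'
    | hom _ b' ν b _ hb =>
      have hν : ρ.K (X.half ν) = ρ.K (X.half (ν - Finsupp.single j 1)) * ρ.k j := by
        rw [k, ← ρ.K_add, ← map_add, sub_add_cancel]
      have hμ : ρ.K (X.half (Finsupp.single j 1 + μ)) = ρ.k j * ρ.K (X.half μ) := by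
        rw [k, ← ρ.K_add, map_add]
      have h1 : ρ.φ (crossRightMap q X (tw q X j c ⊗ₜ[F] (gen j * c')) (b' ⊗ₜ[F] b)) =
          ρ.f (gen j) * ρ.φ (crossRightMap q X (c ⊗ₜ[F] c') (b' ⊗ₜ[F] b)) := by
        rw [ρ.φ_crossRightMap_tmul (hc.tw q X j) hb, ρ.φ_crossRightMap_tmul hc hb,
          ρ.K_mul_f_gen_mul j μ, hc.tw_eq, map_smul, LinearMap.smul_apply, smul_mul_assoc,
          smul_smul, smul_eq_mul, mul_comm (Units.val _), mul_assoc (evT q X c b), ← Units.val_mul,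
          ← zpow_add, add_neg_cancel, zpow_zero, Units.val_one, mul_one, mul_smul_comm]
        simp only [mul_assoc]
      rw [opL_tmul, map_add, LinearMap.add_apply, map_add, h1, add_comm, LinearMap.lTensor_tmul,
        ρ.φ_crossRightMap_tmul (hc.gen_mul j) hb,
        ρ.φ_crossRightMap_tmul hc (hb.skewDer q X j), evT_gen_mul, hμ, hν]
      simp only [mul_smul_comm, smul_mul_assoc, mul_assoc]

lemma crossLeftMap_one (s : T F I ⊗[F] T F I) : ρ.φ (crossLeftMap q X (1 ⊗ₜ[F] 1) s) =
    ρ.e (TensorProduct.lid F _ (LinearMap.rTensor _ (counitT F I).toLinearMap s)) := by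
  induction s using hom_induct₂ with
  | add s s' hs hs' => simp only [map_add, hs, hs']
  | hom _ b' ν b _ hb => simp [ρ.φ_crossLeftMap_tmul .one hb, evT_one]

lemma crossRightMap_one (s : T F I ⊗[F] T F I) : ρ.φ (crossRightMap q X (1 ⊗ₜ[F] 1) s) =
    ρ.e (TensorProduct.rid F _ (LinearMap.lTensor _ (counitT F I).toLinearMap s)) := by
  induction s using hom_induct₂ with
  | add s s' hs hs' => simp only [map_add, hs, hs']
  | hom _ b' ν b _ hb =>
    -- A factor `K_{half ν}` is left next to `b'`; since it is multiplied by the counit of `b`, it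
    -- may be replaced by `K_0 = 1`.
    simp [ρ.φ_crossRightMap_tmul .one hb, evT_one, ρ.K_zero,
      hb.counit_smul fun μ => ρ.e b' * ρ.K (X.half μ)]

lemma φ_crossLeft_gen_mul (j : I) (c b : T F I) :
    ρ.φ (crossLeft q X (projMinus q X (gen j * c)) (projPlus q X b)) =
      ρ.f (gen j) * ρ.φ (crossLeft q X (projMinus q X c) (projPlus q X b)) +
      z • (ρ.k j * ρ.φ (crossLeft q X (projMinus q X c) (projPlus q X (skewDer q X j b))) *
        ρ.k j) := by
  simp only [crossLeft_mk, comulT_gen_mul q X _ (form_degE X), comulT_skewDer]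
  have := ρ.crossLeftMap_opL j (comulT q X (degE I) c) (comulT q X (degE I) b)
  -- The last terms on the two sides of `crossLeftMap_opL` now coincide and cancel.
  rw [rTensor_skewDer_comulT] at this
  exact (add_right_cancel this).symm

lemma φ_crossRight_gen_mul (j : I) (c b : T F I) :
    ρ.φ (crossRight q X (projMinus q X (gen j * c)) (projPlus q X b)) =
      ρ.f (gen j) * ρ.φ (crossRight q X (projMinus q X c) (projPlus q X b)) +
      ρ.k j * ρ.φ (crossRight q X (projMinus q X c) (projPlus q X (skewDer q X j b))) *
        ρ.k j := by
  simp only [crossRight_mk, comulT_gen_mul q X _ (form_degE X), comulT_skewDer]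
  exact ρ.crossRightMap_opL j _ _

lemma φ_crossLeft_one (b : T F I) :
    ρ.φ (crossLeft q X (projMinus q X 1) (projPlus q X b)) = ρ.e b := by
  rw [crossLeft_mk, comulT_one, crossLeftMap_one, counitT_comulT_left]

lemma φ_crossRight_one (b : T F I) :
    ρ.φ (crossRight q X (projMinus q X 1) (projPlus q X b)) = ρ.e b := by
  rw [crossRight_mk, comulT_one, crossRightMap_one, counitT_comulT]

/-- At `z = 1` both sides obey the same recursion in `c` with the same initial value. The induction
keeps `b` arbitrary because the recursion passes to `∂_j b`. -/
lemma φ_crossLeft_eq_crossRight (ρ : Rep q X 1 A) (c : UMinus q X) (b : UPlus q X) :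
    ρ.φ (crossLeft q X c b) = ρ.φ (crossRight q X c b) := by
  obtain ⟨c, rfl⟩ := projMinus_surjective q X c
  obtain ⟨b, rfl⟩ := projPlus_surjective q X b
  induction c using T_induct generalizing b with
  | one => rw [φ_crossLeft_one, φ_crossRight_one]
  | gen_mul j c h => rw [φ_crossLeft_gen_mul, φ_crossRight_gen_mul, h, h, one_smul]
  | add x y hx hy =>
    rw [crossLeft_mk, crossRight_mk]
    simp only [crossLeft_mk, crossRight_mk] at hx hy
    simp only [map_add, LinearMap.add_apply, hx, hy]
  | smul r y hy =>
    rw [crossLeft_mk, crossRight_mk]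
    simp only [crossLeft_mk, crossRight_mk] at hy
    simp only [map_smul, LinearMap.smul_apply, hy]

/-- At `z = 0` the recursion loses its derivative term, so each generator of `C` simply comes out on
the left. -/
lemma γ_mul_β_eq_crossLeft (ρ : Rep q X 0 A) (c : UMinus q X) (b : UPlus q X) :
    ρ.γ c * ρ.β b = ρ.φ (crossLeft q X c b) := by
  obtain ⟨c, rfl⟩ := projMinus_surjective q X c
  obtain ⟨b, rfl⟩ := projPlus_surjective q X b
  induction c using T_induct generalizing b with
  | one => rw [φ_crossLeft_one, map_one, map_one, one_mul]; rfl
  | gen_mul j c h =>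
    rw [φ_crossLeft_gen_mul, zero_smul, add_zero, ← h, map_mul, map_mul, mul_assoc]
    rfl
  | add x y hx hy =>
    rw [crossLeft_mk]
    simp only [crossLeft_mk] at hx hy
    simp only [map_add, LinearMap.add_apply, add_mul, hx, hy]
  | smul r y hy =>
    rw [crossLeft_mk]
    simp only [crossLeft_mk] at hy
    simp only [map_smul, LinearMap.smul_apply, smul_mul_assoc, hy]

/-! ### Smash relations for all elements, and the universal properties -/

lemma η_mul_β (h : Lat F I) (b : UPlus q X) :
    ρ.η h * ρ.β b = ρ.φ (smashPlus q X h b) := by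
  induction h using AddMonoidAlgebra.induction_linear with
  | zero => simp [smashPlus]
  | add x y hx hy => rw [map_add, add_mul, hx, hy]; simp [smashPlus]
  | single κ r =>
    obtain ⟨b, rfl⟩ := projPlus_surjective q X b
    have h : (AddMonoidAlgebra.single κ r : Lat F I) = r • mon F κ := by simp [mon]
    have hs : ∀ b, smashPlus q X (r • mon F κ) b = r • smashPlus q X (mon F κ) b := fun _ => by
      simp only [smashPlus, map_smul]
    rw [h, hs, smashPlus_mon]
    induction b using hom_induct with
    | hom μ b hb =>
      have := ρ.K_mul_e κ hb
      change ρ.η (mon F κ) * ρ.β (projPlus q X b) =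
        _ • (ρ.β (projPlus q X b) * ρ.η (mon F κ)) at this
      rw [actPlus_mk q X κ hb]
      simp only [map_smul, map_mul, φ_jB, φ_jH, smul_mul_assoc, this]
    | add x y hx hy => simp only [map_add, mul_add, add_mul, smul_add, hx, hy]

lemma η_mul_γ (h : Lat F I) (c : UMinus q X) :
    ρ.η h * ρ.γ c = ρ.φ (smashMinus q X h c) := by
  induction h using AddMonoidAlgebra.induction_linear with
  | zero => simp [smashMinus]
  | add x y hx hy => rw [map_add, add_mul, hx, hy]; simp [smashMinus]
  | single κ r =>
    obtain ⟨c, rfl⟩ := projMinus_surjective q X c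
    have h : (AddMonoidAlgebra.single κ r : Lat F I) = r • mon F κ := by simp [mon]
    have hs : ∀ b, smashMinus q X (r • mon F κ) b = r • smashMinus q X (mon F κ) b := fun _ => by
      simp only [smashMinus, map_smul]
    rw [h, hs, smashMinus_mon]
    induction c using hom_induct with
    | hom μ c hc =>
      have := ρ.f_mul_K κ hc
      change ρ.γ (projMinus q X c) * ρ.η (mon F κ) =
        _ • (ρ.η (mon F κ) * ρ.γ (projMinus q X c)) at this
      rw [actMinus_mk q X κ hc]
      simp only [map_smul, map_mul, φ_jC, φ_jH, smul_mul_assoc, this]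
      rw [smul_smul, smul_smul, mul_assoc r, ← Units.val_mul, ← zpow_add, neg_add_cancel, zpow_zero,
        Units.val_one, mul_one]
    | add x y hx hy => simp only [map_add, mul_add, add_mul, smul_add, hx, hy]

lemma φ_eq_of_baseRel {x y : Free q X} (h : BaseRel q X x y) : ρ.φ x = ρ.φ y := by
  cases h with
  | oneC => rw [φ_jC, map_one, map_one]
  | mulC => simp only [map_mul, φ_jC]
  | oneH => rw [φ_jH, map_one, map_one]
  | mulH => simp only [map_mul, φ_jH]
  | oneB => rw [φ_jB, map_one, map_one]
  | mulB => simp only [map_mul, φ_jB]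
  | smashB h b => rw [map_mul, φ_jH, φ_jB, η_mul_β]
  | smashC h c => rw [map_mul, φ_jH, φ_jC, η_mul_γ]

/-- The universal property of the braided Drinfeld double. -/
def drinLift (ρ : Rep q X 1 A) : Drin q X →ₐ[F] A :=
  RingQuot.liftAlgHom F ⟨ρ.φ, fun {x y} h => by
    cases h with
    | base h => exact ρ.φ_eq_of_baseRel h
    | cross c b => exact ρ.φ_crossLeft_eq_crossRight c b⟩

/-- The universal property of the braided Heisenberg double. -/
def heisLift (ρ : Rep q X 0 A) : Heis q X →ₐ[F] A :=
  RingQuot.liftAlgHom F ⟨ρ.φ, fun {x y} h => by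
    cases h with
    | base h => exact ρ.φ_eq_of_baseRel h
    | cross c b => rw [map_mul, φ_jC, φ_jB, γ_mul_β_eq_crossLeft]⟩

lemma drinLift_mk (ρ : Rep q X 1 A) (x : Free q X) : ρ.drinLift (drinMk q X x) = ρ.φ x :=
  RingQuot.liftAlgHom_mkAlgHom_apply ..

lemma heisLift_mk (ρ : Rep q X 0 A) (x : Free q X) : ρ.heisLift (heisMk q X x) = ρ.φ x :=
  RingQuot.liftAlgHom_mkAlgHom_apply ..

end Rep

/-! ### Canonical morphisms to the two doubles -/

namespace Rep

section

variable {q X} {z : F} {A : Type*} [Ring A] [Algebra F A]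

/-- A morphism from the free algebra that respects the relations gives algebra morphisms
from `U_q(n⁻)`, `H` and `U_q(n⁺)`. -/
def ofFree (ψ : Free q X →ₐ[F] A) (hψ : ∀ {x y}, BaseRel q X x y → ψ x = ψ y)
    (cross : ∀ i j, ψ (jC q X (projMinus q X (gen j)) * jB q X (projPlus q X (gen i))) +
      (z * cf q X j i) • ψ (jH q X (mon F (X.half (Finsupp.single j 1))) *
        jH q X (mon F (X.half (Finsupp.single j 1)))) =
      ψ (((q ^ X.dot i j : Fˣ) : F) •
        (jB q X (projPlus q X (gen i)) * jC q X (projMinus q X (gen j)))) + cf q X j i • 1) :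
    Rep q X z A where
  γ := AlgHom.ofLinearMap (ψ.toLinearMap ∘ₗ jC q X) ((hψ .oneC).trans (map_one ψ))
    fun c c' => (hψ (.mulC c c')).trans (map_mul ψ _ _)
  η := AlgHom.ofLinearMap (ψ.toLinearMap ∘ₗ jH q X) ((hψ .oneH).trans (map_one ψ))
    fun h h' => (hψ (.mulH h h')).trans (map_mul ψ _ _)
  β := AlgHom.ofLinearMap (ψ.toLinearMap ∘ₗ jB q X) ((hψ .oneB).trans (map_one ψ))
    fun b b' => (hψ (.mulB b b')).trans (map_mul ψ _ _)
  commB κ i := by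
    have := hψ (.smashB (mon F κ) (projPlus q X (gen i)))
    rw [smashPlus_mon, actPlus_mk q X κ (.gen i), map_smul, smul_mul_assoc, map_smul, map_mul,
      map_mul] at this
    exact this
  commC κ i := by
    have := hψ (.smashC (mon F κ) (projMinus q X (gen i)))
    rw [smashMinus_mon, actMinus_mk q X κ (.gen i), map_smul, smul_mul_assoc, map_smul, map_mul,
      map_mul] at this
    change _ = _ • (ψ (jH q X (mon F κ)) * ψ (jC q X (projMinus q X (gen i))))
    rw [this, smul_smul, ← Units.val_mul, ← zpow_add, add_neg_cancel, zpow_zero, Units.val_one,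
      one_smul]
    rfl
  cross i j := by
    have := cross i j
    rw [map_smul, map_mul, map_mul, map_mul] at this
    exact this

end

lemma drinMk_rel {x y : Free q X} (h : DrinRel q X x y) : drinMk q X x = drinMk q X y :=
  RingQuot.mkAlgHom_rel F h

lemma heisMk_rel {x y : Free q X} (h : HeisRel q X x y) : heisMk q X x = heisMk q X y :=
  RingQuot.mkAlgHom_rel F h

/-- The canonical morphisms to the braided Drinfeld double. -/
def drin : Rep q X 1 (Drin q X) :=
  ofFree (drinMk q X) (fun h => drinMk_rel q X (.base h)) fun i j => by
    have h := drinMk_rel q X (.cross (projMinus q X (gen j)) (projPlus q X (gen i)))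
    have hC : drinMk q X (jC q X 1) = 1 :=
      (drinMk_rel q X (.base .oneC)).trans (map_one _)
    have hH : drinMk q X (jH q X 1) = 1 :=
      (drinMk_rel q X (.base .oneH)).trans (map_one _)
    have hB : drinMk q X (jB q X 1) = 1 :=
      (drinMk_rel q X (.base .oneB)).trans (map_one _)
    -- The double provides `k_j k_i` where `Rep.cross` asks for `k_j²`; the coefficient vanishes
    -- unless `i = j`.
    have hcf : ∀ a : I → Drin q X, cf q X j i • a i = cf q X j i • a j := by
      intro a
      by_cases hij : i = j
      · rw [hij]
      · simp [cf, hij]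
    rw [crossLeft_gen, crossRight_gen] at h
    simp only [map_add, map_smul, map_mul, hC, hH, hB, one_mul, mul_one] at h ⊢
    rw [h, hcf fun i => drinMk q X (jH q X (mon F (X.half (Finsupp.single j 1)))) *
      drinMk q X (jH q X (mon F (X.half (Finsupp.single i 1))))]

/-- The canonical morphisms to the braided Heisenberg double. -/
def heis : Rep q X 0 (Heis q X) :=
  ofFree (heisMk q X) (fun h => heisMk_rel q X (.base h)) fun i j => by
    have h := heisMk_rel q X (.cross (projMinus q X (gen j)) (projPlus q X (gen i)))
    have hC : heisMk q X (jC q X 1) = 1 :=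
      (heisMk_rel q X (.base .oneC)).trans (map_one _)
    have hB : heisMk q X (jB q X 1) = 1 :=
      (heisMk_rel q X (.base .oneB)).trans (map_one _)
    rw [crossLeft_gen] at h
    rw [h, zero_mul, zero_smul, add_zero]
    simp only [map_add, map_smul, map_mul, hC, hB, one_mul]

section

variable {q X} {z : F} {A : Type*} [Ring A] [Algebra F A]

/-! ### Morphisms out of the doubles are determined on generators -/

lemma algHom_ext_of_free {g g' : Free q X →ₐ[F] A}
    (hC : ∀ c, g (jC q X c) = g' (jC q X c)) (hH : ∀ h, g (jH q X h) = g' (jH q X h))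
    (hB : ∀ b, g (jB q X b) = g' (jB q X b)) : g = g' := by
  apply TensorAlgebra.hom_ext
  apply LinearMap.prod_ext
  · exact LinearMap.ext hC
  · apply LinearMap.prod_ext
    · exact LinearMap.ext hH
    · exact LinearMap.ext hB

/-- `B` and `C` are quotients of free algebras, and the `K_κ` span `H`, so agreement on `e_i`,
`f_i`, `K_κ` suffices. -/
lemma algHom_eq_of_gen {P : Type*} [Ring P] [Algebra F P] (σ : Rep q X z P) {g g' : P →ₐ[F] A}
    (he : ∀ i, g (σ.e (gen i)) = g' (σ.e (gen i))) (hf : ∀ i, g (σ.f (gen i)) = g' (σ.f (gen i)))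
    (hK : ∀ κ, g (σ.K κ) = g' (σ.K κ)) :
    (∀ c, g (σ.γ c) = g' (σ.γ c)) ∧ (∀ h, g (σ.η h) = g' (σ.η h)) ∧
      ∀ b, g (σ.β b) = g' (σ.β b) := by
  refine ⟨fun c => ?_, fun h => ?_, fun b => ?_⟩
  · obtain ⟨c, rfl⟩ := projMinus_surjective q X c
    have : g.comp σ.f = g'.comp σ.f := FreeAlgebra.hom_ext (funext hf)
    exact DFunLike.congr_fun this c
  · induction h using AddMonoidAlgebra.induction_linear with
    | zero => simp
    | add x y hx hy => simp only [map_add, hx, hy]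
    | single κ r =>
      have h : (AddMonoidAlgebra.single κ r : Lat F I) = r • mon F κ := by simp [mon]
      rw [h]
      simp only [map_smul]
      rw [show g (σ.η (mon F κ)) = g' (σ.η (mon F κ)) from hK κ]
  · obtain ⟨b, rfl⟩ := projPlus_surjective q X b
    have : g.comp σ.e = g'.comp σ.e := FreeAlgebra.hom_ext (funext he)
    exact DFunLike.congr_fun this b

lemma drin_algHom_ext {g g' : Drin q X →ₐ[F] A}
    (he : ∀ i, g ((drin q X).e (gen i)) = g' ((drin q X).e (gen i)))
    (hf : ∀ i, g ((drin q X).f (gen i)) = g' ((drin q X).f (gen i)))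
    (hK : ∀ κ, g ((drin q X).K κ) = g' ((drin q X).K κ)) : g = g' := by
  obtain ⟨hC, hH, hB⟩ := algHom_eq_of_gen (drin q X) he hf hK
  exact RingQuot.ringQuot_ext' F g g' (algHom_ext_of_free hC hH hB)

lemma heis_algHom_ext {g g' : Heis q X →ₐ[F] A}
    (he : ∀ i, g ((heis q X).e (gen i)) = g' ((heis q X).e (gen i)))
    (hf : ∀ i, g ((heis q X).f (gen i)) = g' ((heis q X).f (gen i)))
    (hK : ∀ κ, g ((heis q X).K κ) = g' ((heis q X).K κ)) : g = g' := by
  obtain ⟨hC, hH, hB⟩ := algHom_eq_of_gen (heis q X) he hf hK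
  exact RingQuot.ringQuot_ext' F g g' (algHom_ext_of_free hC hH hB)

end

/-! ### The counit -/

/-- The counit of `U_q(n⁺)` as an algebra morphism. -/
def counitPlusHom : UPlus q X →ₐ[F] F :=
  AlgHom.ofLinearMap (counitPlus q X) (map_one (counitT F I)) fun b b' => by
    obtain ⟨b, rfl⟩ := projPlus_surjective q X b
    obtain ⟨b', rfl⟩ := projPlus_surjective q X b'
    exact map_mul (counitT F I) b b'

/-- The counit of `U_q(n⁻)` as an algebra morphism. -/
def counitMinusHom : UMinus q X →ₐ[F] F :=
  AlgHom.ofLinearMap (counitMinus q X) (map_one (counitT F I)) fun c c' => by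
    obtain ⟨c, rfl⟩ := projMinus_surjective q X c
    obtain ⟨c', rfl⟩ := projMinus_surjective q X c'
    exact map_mul (counitT F I) c c'

lemma counitPlusHom_gen (i : I) : counitPlusHom q X (projPlus q X (gen i)) = 0 := by
  have := counitT_gen_mul (F := F) i 1
  rwa [mul_one] at this

lemma counitMinusHom_gen (i : I) : counitMinusHom q X (projMinus q X (gen i)) = 0 := by
  have := counitT_gen_mul (F := F) i 1
  rwa [mul_one] at this

/-- The counits of `U_q(n⁻)`, `H` and `U_q(n⁺)`. -/
def counit : Rep q X 1 F where
  γ := counitMinusHom q X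
  η := Bialgebra.counitAlgHom F (Lat F I)
  β := counitPlusHom q X
  commB κ i := by simp [counitPlusHom_gen]
  commC κ i := by simp [counitMinusHom_gen]
  -- With `e_i` and `f_j` sent to `0` and `k_j` to `1`, the relation reads `z c_ij = c_ij`, which
  -- holds because `z = 1`.
  cross i j := by simp [counitPlusHom_gen, counitMinusHom_gen, mon]

/-! ### The coproduct and the coaction -/

section Delta

variable {q X} {z : F} {D : Type*} [Ring D] [Algebra F D] (σ : Rep q X z D)

/-- The map `deltaB` as a function of the coproduct of a representative in the tensor algebra. -/
def deltaBMap : T F I ⊗[F] T F I →ₗ[F] Drin q X ⊗[F] D :=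
  LinearMap.mul' F _ ∘ₗ
    TensorProduct.map ((TensorProduct.mk F (Drin q X) D).flip 1 ∘ₗ drinB q X)
      (TensorProduct.map (drinH q X) σ.β.toLinearMap ∘ₗ rCoactPlus q X) ∘ₗ
    TensorProduct.map (projPlus q X).toLinearMap (projPlus q X).toLinearMap

/-- The map `deltaC` as a function of the coproduct of a representative in the tensor algebra. -/
def deltaCMap : T F I ⊗[F] T F I →ₗ[F] Drin q X ⊗[F] D :=
  LinearMap.mul' F _ ∘ₗ
    TensorProduct.map (TensorProduct.map (drinH q X) σ.γ.toLinearMap ∘ₗ rCoactMinus q X)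
      ((TensorProduct.mk F (Drin q X) D).flip 1 ∘ₗ drinC q X) ∘ₗ
    TensorProduct.map (projMinus q X).toLinearMap (projMinus q X).toLinearMap

lemma deltaB_mk (x : T F I) : deltaB q X σ.β.toLinearMap (projPlus q X x) =
    σ.deltaBMap (comulT q X (degE I) x) := by
  simp only [deltaB, deltaBMap, LinearMap.comp_apply, comulPlus_mk]

lemma deltaC_mk (x : T F I) : deltaC q X σ.γ.toLinearMap (projMinus q X x) =
    σ.deltaCMap (comulT q X (degE I) x) := by
  simp only [deltaC, deltaCMap, LinearMap.comp_apply, comulMinus_mk]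

lemma deltaBMap_tmul (y : T F I) {μ : I →₀ ℤ} {x : T F I} (h : IsHom μ x) :
    σ.deltaBMap (y ⊗ₜ[F] x) = ((drin q X).e y * (drin q X).K (X.half μ)) ⊗ₜ[F] σ.e x := by
  simp only [deltaBMap, LinearMap.comp_apply, TensorProduct.map_tmul, AlgHom.toLinearMap_apply,
    rCoactPlus_mk q X h, LinearMap.mul'_apply, LinearMap.flip_apply, TensorProduct.mk_apply,
    Algebra.TensorProduct.tmul_mul_tmul, one_mul]
  rfl

lemma deltaCMap_tmul (y : T F I) {μ : I →₀ ℤ} {x : T F I} (h : IsHom μ x) :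
    σ.deltaCMap (x ⊗ₜ[F] y) = ((drin q X).K (X.half μ) * (drin q X).f y) ⊗ₜ[F] σ.f x := by
  simp only [deltaCMap, LinearMap.comp_apply, TensorProduct.map_tmul, AlgHom.toLinearMap_apply,
    rCoactMinus_mk q X h, LinearMap.mul'_apply, LinearMap.flip_apply, TensorProduct.mk_apply,
    Algebra.TensorProduct.tmul_mul_tmul, mul_one]
  rfl

/-- The image of `e_i` under the coaction. -/
def deltaE (i : I) : Drin q X ⊗[F] D :=
  (drin q X).e (gen i) ⊗ₜ[F] 1 + (drin q X).k i ⊗ₜ[F] σ.e (gen i)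

/-- The image of `f_i` under the coaction. -/
def deltaF (i : I) : Drin q X ⊗[F] D :=
  (drin q X).f (gen i) ⊗ₜ[F] 1 + (drin q X).k i ⊗ₜ[F] σ.f (gen i)

/-- The braided twist `tw_i` on the first leg is realized by commuting `k_i` past it (`e_tw_mul_k`).
Thus the braided product becomes the ordinary product of the tensor product algebra. -/
lemma deltaBMap_opL (i : I) (t : T F I ⊗[F] T F I) :
    σ.deltaBMap (opL q X i t) = σ.deltaE i * σ.deltaBMap t := by
  induction t using hom_induct₂ with
  | add s t hs ht => rw [map_add, map_add, hs, ht, map_add, mul_add]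
  | hom _ y μ x _ hx =>
    rw [opL_tmul, map_add, σ.deltaBMap_tmul _ hx, σ.deltaBMap_tmul _ hx,
      σ.deltaBMap_tmul _ (hx.gen_mul i), deltaE, add_mul, Algebra.TensorProduct.tmul_mul_tmul,
      Algebra.TensorProduct.tmul_mul_tmul, map_add X.half, K_add, ← mul_assoc]
    change _ + (_ * (drin q X).k i * _) ⊗ₜ _ = _
    rw [e_tw_mul_k, map_mul, map_mul, one_mul, mul_assoc, mul_assoc]

/-- Here the twist falls on the leg that lands in `D`; being the scalar `q^(i·μ)`, it cancels
against moving `f_i` in front of `K_{half μ}`. -/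
lemma deltaCMap_opL (i : I) (t : T F I ⊗[F] T F I) :
    σ.deltaCMap (opL q X i t) = σ.deltaF i * σ.deltaCMap t := by
  induction t using hom_induct₂ with
  | add s t hs ht => rw [map_add, map_add, hs, ht, map_add, mul_add]
  | hom μ x _ y hx _ =>
    rw [opL_tmul, map_add, σ.deltaCMap_tmul _ hx, σ.deltaCMap_tmul _ (hx.tw q X i),
      σ.deltaCMap_tmul _ (hx.gen_mul i), deltaF, add_mul, Algebra.TensorProduct.tmul_mul_tmul,
      Algebra.TensorProduct.tmul_mul_tmul, map_add X.half, K_add, K_mul_f_gen_mul _ _ μ, hx.tw_eq,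
      map_smul, TensorProduct.tmul_smul, TensorProduct.smul_tmul', smul_smul, ← Units.val_mul,
      ← zpow_add, add_neg_cancel, zpow_zero, Units.val_one, one_smul, map_mul, one_mul,
      add_comm, mul_assoc]
    rfl

lemma deltaB_one : deltaB q X σ.β.toLinearMap 1 = 1 := by
  rw [← map_one (projPlus q X), deltaB_mk, comulT_one, σ.deltaBMap_tmul _ .one, map_one, map_one,
    map_zero, K_zero, mul_one, Algebra.TensorProduct.one_def]

lemma deltaC_one : deltaC q X σ.γ.toLinearMap 1 = 1 := by
  rw [← map_one (projMinus q X), deltaC_mk, comulT_one, σ.deltaCMap_tmul _ .one, map_one, map_one,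
    map_zero, K_zero, mul_one, Algebra.TensorProduct.one_def]

lemma deltaB_gen_mul (i : I) (x : T F I) :
    deltaB q X σ.β.toLinearMap (projPlus q X (gen i * x)) =
      σ.deltaE i * deltaB q X σ.β.toLinearMap (projPlus q X x) := by
  rw [deltaB_mk, deltaB_mk, comulT_gen_mul q X _ (form_degE X), deltaBMap_opL]

lemma deltaC_gen_mul (i : I) (x : T F I) :
    deltaC q X σ.γ.toLinearMap (projMinus q X (gen i * x)) =
      σ.deltaF i * deltaC q X σ.γ.toLinearMap (projMinus q X x) := by
  rw [deltaC_mk, deltaC_mk, comulT_gen_mul q X _ (form_degE X), deltaCMap_opL]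

lemma deltaB_gen (i : I) :
    deltaB q X σ.β.toLinearMap (projPlus q X (gen i)) = σ.deltaE i := by
  have := σ.deltaB_gen_mul i 1
  rwa [map_one, deltaB_one, mul_one, mul_one] at this

lemma deltaC_gen (i : I) :
    deltaC q X σ.γ.toLinearMap (projMinus q X (gen i)) = σ.deltaF i := by
  have := σ.deltaC_gen_mul i 1
  rwa [map_one, deltaC_one, mul_one, mul_one] at this

/-- Multiplicativity in general follows from the case of a generator on the left, by induction on a
representative of the first factor. -/
lemma deltaB_mul (b b' : UPlus q X) : deltaB q X σ.β.toLinearMap (b * b') =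
    deltaB q X σ.β.toLinearMap b * deltaB q X σ.β.toLinearMap b' := by
  obtain ⟨b, rfl⟩ := projPlus_surjective q X b
  obtain ⟨b', rfl⟩ := projPlus_surjective q X b'
  induction b using T_induct with
  | one => rw [map_one, deltaB_one, one_mul, one_mul]
  | gen_mul i y h =>
    rw [deltaB_gen_mul, mul_assoc, ← h, ← map_mul, mul_assoc, deltaB_gen_mul, map_mul]
  | add x y hx hy => simp only [map_add, add_mul, hx, hy]
  | smul r y hy => simp only [map_smul, smul_mul_assoc, hy]

lemma deltaC_mul (c c' : UMinus q X) : deltaC q X σ.γ.toLinearMap (c * c') =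
    deltaC q X σ.γ.toLinearMap c * deltaC q X σ.γ.toLinearMap c' := by
  obtain ⟨c, rfl⟩ := projMinus_surjective q X c
  obtain ⟨c', rfl⟩ := projMinus_surjective q X c'
  induction c using T_induct with
  | one => rw [map_one, deltaC_one, one_mul, one_mul]
  | gen_mul i y h =>
    rw [deltaC_gen_mul, mul_assoc, ← h, ← map_mul, mul_assoc, deltaC_gen_mul, map_mul]
  | add x y hx hy => simp only [map_add, add_mul, hx, hy]
  | smul r y hy => simp only [map_smul, smul_mul_assoc, hy]

/-- The map `deltaH` as an algebra morphism. -/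
def deltaHHom : Lat F I →ₐ[F] Drin q X ⊗[F] D :=
  (Algebra.TensorProduct.map (drin q X).η σ.η).comp
    ((Algebra.TensorProduct.comm F (Lat F I) (Lat F I)).toAlgHom.comp
      (Bialgebra.comulAlgHom F (Lat F I)))

lemma deltaHHom_apply (h : Lat F I) : σ.deltaHHom h = deltaH q X σ.η.toLinearMap h := rfl

lemma deltaHHom_mon (κ : I →₀ ℤ) : σ.deltaHHom (mon F κ) = (drin q X).K κ ⊗ₜ[F] σ.K κ := by
  rw [deltaHHom_apply, deltaH, LinearMap.comp_apply, LinearMap.comp_apply, comul_mon]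
  rfl

end Delta

end Rep

/-! ### The coproduct and the coaction as one representation -/

namespace Rep

section

variable {q X} {z : F} {D : Type*} [Ring D] [Algebra F D] (σ : Rep q X z D)

lemma K_comm (μ ν : I →₀ ℤ) : σ.K μ * σ.K ν = σ.K ν * σ.K μ := by
  rw [← K_add, ← K_add, add_comm]

lemma K_mul_e_gen (κ : I →₀ ℤ) (i : I) : σ.K κ * σ.e (gen i) =
    ((q ^ X.cartanForm κ (Finsupp.single i 1) : Fˣ) : F) • (σ.e (gen i) * σ.K κ) :=
  σ.K_mul_e κ (.gen i)

lemma f_gen_mul_K (κ : I →₀ ℤ) (i : I) : σ.f (gen i) * σ.K κ =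
    ((q ^ X.cartanForm κ (Finsupp.single i 1) : Fˣ) : F) • (σ.K κ * σ.f (gen i)) :=
  σ.f_mul_K κ (.gen i)

lemma k_mul_e_gen (i j : I) : σ.k j * σ.e (gen i) =
    ((q ^ X.dot i j : Fˣ) : F) • (σ.e (gen i) * σ.k j) := by
  rw [k, K_mul_e_gen, X.cartanForm_half, X.dot_comm]
  rfl

lemma f_gen_mul_k (i j : I) : σ.f (gen j) * σ.k i =
    ((q ^ X.dot i j : Fˣ) : F) • (σ.k i * σ.f (gen j)) := by
  rw [k, f_gen_mul_K, X.cartanForm_half]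
  rfl

lemma f_gen_mul_e_gen (i j : I) : σ.f (gen j) * σ.e (gen i) =
    ((q ^ X.dot i j : Fˣ) : F) • (σ.e (gen i) * σ.f (gen j)) + cf q X j i • 1 -
      (z * cf q X j i) • (σ.k j * σ.k j) :=
  eq_sub_of_add_eq (σ.cross i j)

/-- The morphisms to `Drin ⊗ D` that define the coproduct and the coaction. -/
def delta : Rep q X z (Drin q X ⊗[F] D) where
  γ := AlgHom.ofLinearMap (deltaC q X σ.γ.toLinearMap) σ.deltaC_one σ.deltaC_mul
  η := σ.deltaHHom
  β := AlgHom.ofLinearMap (deltaB q X σ.β.toLinearMap) σ.deltaB_one σ.deltaB_mul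
  commB κ i := by
    change σ.deltaHHom (mon F κ) * deltaB q X σ.β.toLinearMap (projPlus q X (gen i)) =
      _ • (deltaB q X σ.β.toLinearMap (projPlus q X (gen i)) * σ.deltaHHom (mon F κ))
    rw [deltaHHom_mon, deltaB_gen, deltaE]
    simp only [mul_add, add_mul, Algebra.TensorProduct.tmul_mul_tmul, K_mul_e_gen, one_mul,
      mul_one, smul_add, TensorProduct.smul_tmul', TensorProduct.tmul_smul, k,
      K_comm _ κ (X.half _)]
  commC κ i := by
    change deltaC q X σ.γ.toLinearMap (projMinus q X (gen i)) * σ.deltaHHom (mon F κ) =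
      _ • (σ.deltaHHom (mon F κ) * deltaC q X σ.γ.toLinearMap (projMinus q X (gen i)))
    rw [deltaHHom_mon, deltaC_gen, deltaF]
    simp only [mul_add, add_mul, Algebra.TensorProduct.tmul_mul_tmul, f_gen_mul_K, one_mul,
      mul_one, smul_add, TensorProduct.smul_tmul', TensorProduct.tmul_smul, k,
      K_comm _ κ (X.half _)]
  cross i j := by
    change deltaC q X σ.γ.toLinearMap (projMinus q X (gen j)) *
        deltaB q X σ.β.toLinearMap (projPlus q X (gen i)) +
        (z * cf q X j i) • (σ.deltaHHom (mon F (X.half (Finsupp.single j 1))) *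
        σ.deltaHHom (mon F (X.half (Finsupp.single j 1)))) =
      _ • (deltaB q X σ.β.toLinearMap (projPlus q X (gen i)) *
        deltaC q X σ.γ.toLinearMap (projMinus q X (gen j))) + _
    have hcf : ∀ a : I → Drin q X ⊗[F] D, cf q X j i • a i = cf q X j i • a j := by
      intro a
      by_cases hij : i = j
      · rw [hij]
      · simp [cf, hij]
    -- The mixed terms match by commuting `k_i` with `f_j` and `k_j` with `e_i`. What remains are
    -- `k_j k_i ⊗ 1` against `k_j² ⊗ 1`, and `k_j k_i ⊗ k_j²` against `k_j² ⊗ k_j²`; `hcf1` and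
    -- `hcf2` identify these, the second with coefficient `z`.
    have hcf1 := hcf fun i => ((drin q X).k j * (drin q X).k i) ⊗ₜ[F] (1 : D)
    have hcf2 := hcf fun i => ((drin q X).k j * (drin q X).k i) ⊗ₜ[F] (σ.k j * σ.k j)
    have hk : (drin q X).k i * (drin q X).k j = (drin q X).k j * (drin q X).k i := K_comm ..
    rw [deltaHHom_mon, deltaB_gen, deltaC_gen, deltaE, deltaF]
    change _ + _ • ((drin q X).k j ⊗ₜ[F] σ.k j * (drin q X).k j ⊗ₜ[F] σ.k j) = _
    simp only [mul_add, add_mul, Algebra.TensorProduct.tmul_mul_tmul, f_gen_mul_k, k_mul_e_gen,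
      f_gen_mul_e_gen, one_mul, mul_one, smul_add, TensorProduct.smul_tmul',
      TensorProduct.tmul_smul, TensorProduct.add_tmul, TensorProduct.tmul_add,
      TensorProduct.sub_tmul, TensorProduct.tmul_sub, hk, Algebra.TensorProduct.one_def]
    simp only [← TensorProduct.smul_tmul'] at hcf1 hcf2 ⊢
    linear_combination (norm := module) hcf1 - z • hcf2

lemma delta_e_gen (i : I) : σ.delta.e (gen i) = σ.deltaE i := σ.deltaB_gen i

lemma delta_f_gen (i : I) : σ.delta.f (gen i) = σ.deltaF i := σ.deltaC_gen i

lemma delta_K (κ : I →₀ ℤ) : σ.delta.K κ = (drin q X).K κ ⊗ₜ[F] σ.K κ := σ.deltaHHom_mon κ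

end

/-! ### The structure maps and their values on generators -/

section

variable {q X} {A : Type*} [Ring A] [Algebra F A]

lemma drinLift_drinB (ρ : Rep q X 1 A) (b) : ρ.drinLift (drinB q X b) = ρ.β b :=
  (ρ.drinLift_mk _).trans (ρ.φ_jB b)

lemma drinLift_drinC (ρ : Rep q X 1 A) (c) : ρ.drinLift (drinC q X c) = ρ.γ c :=
  (ρ.drinLift_mk _).trans (ρ.φ_jC c)

lemma drinLift_drinH (ρ : Rep q X 1 A) (h) : ρ.drinLift (drinH q X h) = ρ.η h :=
  (ρ.drinLift_mk _).trans (ρ.φ_jH h)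

lemma heisLift_heisB (ρ : Rep q X 0 A) (b) : ρ.heisLift (heisB q X b) = ρ.β b :=
  (ρ.heisLift_mk _).trans (ρ.φ_jB b)

lemma heisLift_heisC (ρ : Rep q X 0 A) (c) : ρ.heisLift (heisC q X c) = ρ.γ c :=
  (ρ.heisLift_mk _).trans (ρ.φ_jC c)

lemma heisLift_heisH (ρ : Rep q X 0 A) (h) : ρ.heisLift (heisH q X h) = ρ.η h :=
  (ρ.heisLift_mk _).trans (ρ.φ_jH h)

end

/-- The coproduct of the braided Drinfeld double. -/
def comulDrin : Drin q X →ₐ[F] Drin q X ⊗[F] Drin q X := (drin q X).delta.drinLift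

/-- The counit of the braided Drinfeld double. -/
def counitDrin : Drin q X →ₐ[F] F := (counit q X).drinLift

/-- The coaction of the braided Drinfeld double on the braided Heisenberg double. -/
def coactHeis : Heis q X →ₐ[F] Drin q X ⊗[F] Heis q X := (heis q X).delta.heisLift

lemma comulDrin_e (i : I) : comulDrin q X ((drin q X).e (gen i)) =
    (drin q X).e (gen i) ⊗ₜ[F] 1 + (drin q X).k i ⊗ₜ[F] (drin q X).e (gen i) :=
  (drinLift_drinB _ _).trans (delta_e_gen _ i)

lemma comulDrin_f (i : I) : comulDrin q X ((drin q X).f (gen i)) =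
    (drin q X).f (gen i) ⊗ₜ[F] 1 + (drin q X).k i ⊗ₜ[F] (drin q X).f (gen i) :=
  (drinLift_drinC _ _).trans (delta_f_gen _ i)

lemma comulDrin_K (κ : I →₀ ℤ) : comulDrin q X ((drin q X).K κ) =
    (drin q X).K κ ⊗ₜ[F] (drin q X).K κ :=
  (drinLift_drinH _ _).trans (delta_K _ κ)

lemma coactHeis_e (i : I) : coactHeis q X ((heis q X).e (gen i)) =
    (drin q X).e (gen i) ⊗ₜ[F] 1 + (drin q X).k i ⊗ₜ[F] (heis q X).e (gen i) :=
  (heisLift_heisB _ _).trans (delta_e_gen _ i)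

lemma coactHeis_f (i : I) : coactHeis q X ((heis q X).f (gen i)) =
    (drin q X).f (gen i) ⊗ₜ[F] 1 + (drin q X).k i ⊗ₜ[F] (heis q X).f (gen i) :=
  (heisLift_heisC _ _).trans (delta_f_gen _ i)

lemma coactHeis_K (κ : I →₀ ℤ) : coactHeis q X ((heis q X).K κ) =
    (drin q X).K κ ⊗ₜ[F] (heis q X).K κ :=
  (heisLift_heisH _ _).trans (delta_K _ κ)

lemma counitDrin_e (i : I) : counitDrin q X ((drin q X).e (gen i)) = 0 :=
  (drinLift_drinB _ _).trans (counitPlusHom_gen q X i)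

lemma counitDrin_f (i : I) : counitDrin q X ((drin q X).f (gen i)) = 0 :=
  (drinLift_drinC _ _).trans (counitMinusHom_gen q X i)

lemma counitDrin_K (κ : I →₀ ℤ) : counitDrin q X ((drin q X).K κ) = 1 :=
  (drinLift_drinH _ _).trans (by simp [counit, mon])

lemma comulDrin_k (i : I) : comulDrin q X ((drin q X).k i) =
    (drin q X).k i ⊗ₜ[F] (drin q X).k i := comulDrin_K ..

lemma counitDrin_k (i : I) : counitDrin q X ((drin q X).k i) = 1 := counitDrin_K ..

theorem isBialgebra_drin : IsBialgebra (comulDrin q X) (counitDrin q X) where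
  coassoc u := by
    suffices h : (Algebra.TensorProduct.assoc F F F (Drin q X) (Drin q X) (Drin q X)).toAlgHom.comp
        ((Algebra.TensorProduct.map (comulDrin q X) (AlgHom.id F _)).comp (comulDrin q X)) =
        (Algebra.TensorProduct.map (AlgHom.id F _) (comulDrin q X)).comp (comulDrin q X) from
      DFunLike.congr_fun h u
    -- Both sides send `e_i` to `e_i ⊗ 1 ⊗ 1 + k_i ⊗ e_i ⊗ 1 + k_i ⊗ k_i ⊗ e_i`, and `f_i` likewise,
    -- while `K_κ` is grouplike.
    apply drin_algHom_ext <;> intro i <;>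
      simp [comulDrin_e, comulDrin_f, comulDrin_K, comulDrin_k, TensorProduct.add_tmul,
        TensorProduct.tmul_add, Algebra.TensorProduct.one_def, add_assoc]
  counit_left u := by
    suffices h : (Algebra.TensorProduct.map (counitDrin q X) (AlgHom.id F _)).comp
        (comulDrin q X) = Algebra.TensorProduct.includeRight from DFunLike.congr_fun h u
    apply drin_algHom_ext <;> intro i <;>
      simp [comulDrin_e, comulDrin_f, comulDrin_K, counitDrin_e, counitDrin_f, counitDrin_K,
        counitDrin_k]
  counit_right u := by
    suffices h : (Algebra.TensorProduct.map (AlgHom.id F _) (counitDrin q X)).comp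
        (comulDrin q X) = Algebra.TensorProduct.includeLeft from DFunLike.congr_fun h u
    apply drin_algHom_ext <;> intro i <;>
      simp [comulDrin_e, comulDrin_f, comulDrin_K, counitDrin_e, counitDrin_f, counitDrin_K]

theorem isLeftComoduleAlgebra_heis :
    IsLeftComoduleAlgebra (comulDrin q X) (counitDrin q X) (coactHeis q X) where
  coassoc x := by
    suffices h : (Algebra.TensorProduct.assoc F F F (Drin q X) (Drin q X) (Heis q X)).toAlgHom.comp
        ((Algebra.TensorProduct.map (comulDrin q X) (AlgHom.id F _)).comp (coactHeis q X)) =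
        (Algebra.TensorProduct.map (AlgHom.id F _) (coactHeis q X)).comp (coactHeis q X) from
      DFunLike.congr_fun h x
    -- The computation for the coproduct repeats, with the last tensor factor now in the Heisenberg
    -- double.
    apply heis_algHom_ext <;> intro i <;>
      simp [coactHeis_e, coactHeis_f, coactHeis_K, comulDrin_e, comulDrin_f, comulDrin_K,
        comulDrin_k, TensorProduct.add_tmul, TensorProduct.tmul_add,
        Algebra.TensorProduct.one_def, add_assoc]
  counit x := by
    suffices h : (Algebra.TensorProduct.map (counitDrin q X) (AlgHom.id F _)).comp
        (coactHeis q X) = Algebra.TensorProduct.includeRight from DFunLike.congr_fun h x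
    apply heis_algHom_ext <;> intro i <;>
      simp [coactHeis_e, coactHeis_f, coactHeis_K, counitDrin_e, counitDrin_f, counitDrin_K,
        counitDrin_k]

end Rep

end QuantumWeyl

end

/-! ### Specialization to the field `k(q)` -/

open QuantumWeyl in
theorem corollary3p23 (k : Type*) [Field k] {I : Type*} (X : CartanDatum I) :
    ∃ (Δ : Uq k X →ₐ[RatFunc k] Uq k X ⊗[RatFunc k] Uq k X) (ε : Uq k X →ₐ[RatFunc k] RatFunc k),
      IsBialgebra Δ ε ∧
      (∀ b, Δ (drinB (qVar k) X b) = deltaB (qVar k) X (drinB (qVar k) X) b) ∧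
      (∀ c, Δ (drinC (qVar k) X c) = deltaC (qVar k) X (drinC (qVar k) X) c) ∧
      (∀ h, Δ (drinH (qVar k) X h) = deltaH (qVar k) X (drinH (qVar k) X) h) ∧
      (∀ b, ε (drinB (qVar k) X b) = counitPlus (qVar k) X b) ∧
      (∀ c, ε (drinC (qVar k) X c) = counitMinus (qVar k) X c) ∧
      (∀ h, ε (drinH (qVar k) X h) = Coalgebra.counit h) ∧
      ∃ δ : Dq k X →ₐ[RatFunc k] Uq k X ⊗[RatFunc k] Dq k X,
        IsLeftComoduleAlgebra Δ ε δ ∧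
        (∀ b, δ (heisB (qVar k) X b) = deltaB (qVar k) X (heisB (qVar k) X) b) ∧
        (∀ c, δ (heisC (qVar k) X c) = deltaC (qVar k) X (heisC (qVar k) X) c) ∧
        (∀ h, δ (heisH (qVar k) X h) = deltaH (qVar k) X (heisH (qVar k) X) h) :=
  ⟨Rep.comulDrin (qVar k) X, Rep.counitDrin (qVar k) X, Rep.isBialgebra_drin (qVar k) X,
    Rep.drinLift_drinB _, Rep.drinLift_drinC _, Rep.drinLift_drinH _,
    Rep.drinLift_drinB _, Rep.drinLift_drinC _, Rep.drinLift_drinH _,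
    Rep.coactHeis (qVar k) X, Rep.isLeftComoduleAlgebra_heis (qVar k) X,
    Rep.heisLift_heisB _, Rep.heisLift_heisC _, Rep.heisLift_heisH _⟩
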